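/- Let $K\subset\mathbb R^2$ be a compact, strictly convex domain with nonempty interior, enclosed by a smooth ($C^\infty$) simple closed curve $\gamma$ of everywhere positive curvature $\kappa$. Let $p_K(\theta)=\max_{x\in K}\langle x,(\cos\theta,\sin\theta)\rangle$ be the support function of $K$, and parametrize $\gamma$ by the angle $\theta$ of its outward normal: $$\gamma(\theta)=\bigl(p_K(\theta)\cos\theta-p_K'(\theta)\sin\theta,\;p_K(\theta)\sin\theta+p_K'(\theta)\cos\theta\bigr).$$ Let $\rho=1/\kappa$ be the curvature radius of $\gamma$, $L$ the length of $\gamma$, $A$ the area of $K$, $\beta(\theta)=\gamma(\theta)-\rho(\theta)(\cos\theta,\sin\theta)$ the locus of the curvature centers, $\tilde A=\frac12\oint_\beta(\beta_1\,d\beta_2-\beta_2\,d\beta_1)$ its oriented area, $\rho_\beta(\theta)$ the (unsigned) curvature radius of $\beta$ (taken to be $0$ where $\beta'(\theta)=0$), $\rho_e$ and $\rho_i$ the circumradius and the inradius of $K$, and $\rho_M$, $\rho_m$ the maximum and the minimum of $\rho$. For real parameters $\alpha,\delta,\mu,\sigma,\eta,\lambda,\xi,\zeta$ put $$W=\alpha\int_0^{2\pi}\rho^2\,d\theta+\delta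 L^2+\mu A+\sigma|\tilde A|+\eta\int_0^{2\pi}\rho_\beta^2\,d\theta+\lambda(\rho_e-\rho_i)^2+\xi(\rho_M-\rho_m)^2+\zeta\oint_\gamma\kappa^2\,ds,$$ $$D=6\pi\alpha-\pi\mu+4\pi\sigma+24\pi\eta+4\lambda+4\xi-12\pi\zeta,\qquad C=\max\Bigl\{1,\frac{3}{2D}\Bigr\}.$$ Let $S(K)$ be the Steiner disk of $K$, i.e. the closed disk with center $\frac1\pi\int_0^{2\pi}p_K(\theta)(\cos\theta,\sin\theta)\,d\theta$ and radius $\frac{L}{2\pi}$, and let $h_1(K,S(K))=\max_{\theta\in[0,2\pi]}|p_K(\theta)-p_{S(K)}(\theta)|$. (i) If $\eta,\xi,\zeta\ge0$, $\lambda\le0$, $2\alpha+4\pi\delta+\mu-4\zeta\ge0$, $2\alpha+\sigma-2\eta-4\zeta\ge0$ and $D>0$, then $$h_1(K,S(K))^2\le C\,W.$$ (ii) If $K$ is a disk, $2\alpha+4\pi\delta+\mu=0$ and $\zeta=0$, then $h_1(K,S(K))^2=C\,W$ (where $C$ is read as $1$ should $D$ be $0$; both sides are in fact $0$). -/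

import Mathlib

open Real MeasureTheory
open scoped ContDiff

noncomputable section

/-- The Euclidean plane. -/
abbrev Plane : Type := EuclideanSpace ℝ (Fin 2)

/-- The unit vector at angle `θ` from the `x`-axis. -/
def unitVec (θ : ℝ) : Plane := !₂[cos θ, sin θ]

/-- The planar cross product (determinant) of two vectors. -/
def planeCross (v w : Plane) : ℝ := v 0 * w 1 - v 1 * w 0

/-- Signed curvature `(c₁' c₂'' - c₂' c₁'') / (c₁'² + c₂'²)^(3/2)` of a parametrized plane curve,
meaningful where `c' ≠ 0`. -/
def curveCurvature (c : ℝ → Plane) (t : ℝ) : ℝ :=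
  planeCross (deriv c t) (deriv (deriv c) t) / ‖deriv c t‖ ^ 3

/-- `K` is a closed, bounded, strictly convex domain enclosed by a smooth curve of positive
curvature: its boundary is traced exactly once by a closed regular `C^∞` curve whose curvature
(for the counterclockwise orientation) is positive. -/
structure IsSmoothStrictlyConvexDomain (K : Set Plane) : Prop where
  isCompact : IsCompact K
  nonempty_interior : (interior K).Nonempty
  strictConvex : StrictConvex ℝ K
  boundary : ∃ (c : ℝ → Plane) (T : ℝ), 0 < T ∧ ContDiff ℝ ∞ c ∧ Function.Periodic c T ∧
    Set.InjOn c (Set.Ico 0 T) ∧ (∀ t, deriv c t ≠ 0) ∧ (∀ t, 0 < curveCurvature c t) ∧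
    Set.range c = frontier K

/-- The support function `p_K(θ)`, where `θ` is the angle of the outward normal. -/
def supportFn (K : Set Plane) (θ : ℝ) : ℝ :=
  sSup ((fun x : Plane => inner ℝ x (unitVec θ)) '' K)

/-- The boundary curve `γ`, parametrized by the angle `θ` of its outward normal. -/
def boundaryCurve (K : Set Plane) (θ : ℝ) : Plane :=
  !₂[supportFn K θ * cos θ - deriv (supportFn K) θ * sin θ,
     supportFn K θ * sin θ + deriv (supportFn K) θ * cos θ]

/-- The curvature `κ` of `γ`. -/
def curvature (K : Set Plane) (θ : ℝ) : ℝ := curveCurvature (boundaryCurve K) θ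

/-- The curvature radius `ρ` of `γ`. -/
def curvatureRadius (K : Set Plane) (θ : ℝ) : ℝ := 1 / curvature K θ

/-- The length `L` of `γ`. -/
def perimeter (K : Set Plane) : ℝ := ∫ θ in (0 : ℝ)..(2 * π), ‖deriv (boundaryCurve K) θ‖

/-- The area `A` of the region enclosed by `γ`. -/
def area (K : Set Plane) : ℝ := (volume : Measure Plane).real K

/-- The locus `β` of the curvature centers: `β = γ + ρ N` with `N` the inward unit normal. -/
def centerLocus (K : Set Plane) (θ : ℝ) : Plane :=
  boundaryCurve K θ - curvatureRadius K θ • unitVec θ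

/-- The oriented area `Ã = ½ ∮_β (β₁ dβ₂ - β₂ dβ₁)`. -/
def orientedAreaLocus (K : Set Plane) : ℝ :=
  (1 / 2) * ∫ θ in (0 : ℝ)..(2 * π), planeCross (centerLocus K θ) (deriv (centerLocus K) θ)

open Classical in
/-- The (unsigned) curvature radius `ρ_β` of `β`; it is `0` at the singular points of `β`. -/
def locusCurvatureRadius (K : Set Plane) (θ : ℝ) : ℝ :=
  if deriv (centerLocus K) θ = 0 then 0 else |1 / curveCurvature (centerLocus K) θ|

/-- The circumradius `ρ_e`: the least radius of a disk containing `K`. -/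
def outerRadius (K : Set Plane) : ℝ :=
  sInf {R : ℝ | 0 ≤ R ∧ ∃ x : Plane, K ⊆ Metric.closedBall x R}

/-- The inradius `ρ_i`: the largest radius of a disk contained in `K`. -/
def innerRadius (K : Set Plane) : ℝ :=
  sSup {r : ℝ | 0 ≤ r ∧ ∃ x : Plane, Metric.closedBall x r ⊆ K}

/-- The maximum `ρ_M` of the curvature radius. -/
def maxCurvatureRadius (K : Set Plane) : ℝ := sSup (curvatureRadius K '' Set.Icc 0 (2 * π))

/-- The minimum `ρ_m` of the curvature radius. -/
def minCurvatureRadius (K : Set Plane) : ℝ := sInf (curvatureRadius K '' Set.Icc 0 (2 * π))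

/-- `∮_γ κ² ds`. -/
def curvatureSqIntegral (K : Set Plane) : ℝ :=
  ∫ θ in (0 : ℝ)..(2 * π), curvature K θ ^ 2 * ‖deriv (boundaryCurve K) θ‖

/-- The functional `W` with parameters `(α, δ, μ, σ, η, λ, ξ, ζ)`. -/
def isoW (α δ μ σ η lam ξ ζ : ℝ) (K : Set Plane) : ℝ :=
  α * (∫ θ in (0 : ℝ)..(2 * π), curvatureRadius K θ ^ 2)
    + δ * perimeter K ^ 2 + μ * area K + σ * |orientedAreaLocus K|
    + η * (∫ θ in (0 : ℝ)..(2 * π), locusCurvatureRadius K θ ^ 2)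
    + lam * (outerRadius K - innerRadius K) ^ 2
    + ξ * (maxCurvatureRadius K - minCurvatureRadius K) ^ 2
    + ζ * curvatureSqIntegral K

/-- The distance `h₁(K, K') = max_{θ ∈ [0, 2π]} |p_K(θ) - p_{K'}(θ)|`. -/
def h1Dist (K K' : Set Plane) : ℝ :=
  sSup ((fun θ => |supportFn K θ - supportFn K' θ|) '' Set.Icc 0 (2 * π))

/-- The Steiner point `(1/π) ∫ p_K(θ) (cos θ, sin θ) dθ`. -/
def steinerPoint (K : Set Plane) : Plane :=
  !₂[(1 / π) * ∫ θ in (0 : ℝ)..(2 * π), supportFn K θ * cos θ,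
     (1 / π) * ∫ θ in (0 : ℝ)..(2 * π), supportFn K θ * sin θ]

/-- The Steiner disk: centered at the Steiner point, with the same perimeter as `K`. -/
def steinerDisk (K : Set Plane) : Set Plane :=
  Metric.closedBall (steinerPoint K) (perimeter K / (2 * π))

/-- The stability constant. -/
def stabilityConst (α μ σ η lam ξ ζ : ℝ) : ℝ :=
  max 1 (3 / (2 * (6 * π * α - π * μ + 4 * π * σ + 24 * π * η + 4 * lam + 4 * ξ - 12 * π * ζ)))

end

/-! Every quantity is compared with the isoperimetric deficit `L² - 4πA`, through the Fourier
coefficients of the support function `p`. Let `v n = |p̂ n|²` for `n ≠ 0` and `Mⱼ = ∑ n^(2j) v n`.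
Since `ρ = p + p''` and `β' = -ρ' (cos θ, sin θ)`, Parseval gives `L² - 4πA = 4π² (M₁ - M₀)`, `∫ ρ²
= L²/(2π) + 2π (M₀ - 2M₁ + M₂)`, `|Ã| = π (M₂ - M₁)` and `∫ ρ_β² = 2π (M₁ - 2M₂ + M₃)`.

Upper bound for the distance (`h1Dist_sq_le`): the modes `|n| ≤ 1` of `p` are exactly the support
function of the Steiner disk, so `p - p_S` is the sum of the other modes. Cauchy–Schwarz with
weights `n² - 1` and `∑_{|n| ≥ 2} 1/(n² - 1) = 3/2` give `h₁² ≤ (3/2)(M₁ - M₀)`.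

Lower bound for the functional (`le_isoW`): `W ≥ D (M₁ - M₀)`. The quadratic integral terms reduce
to the nonnegativity of a polynomial in `N = n²` on `N = 1` and `N ≥ 4`; `D` is tuned so that this
polynomial has the factor `(N - 1)(N - 4)`. The term with `λ ≤ 0` is controlled by Bonnesen's
inequality, the term with `ξ ≥ 0` by a variance bound for `ρ`, and the `ζ` term by dropping
nonnegative integrals. Combining the two bounds gives (i). For a disk the deficit is zero, hence so
is `h₁`, and `W` is a multiple of `2α + 4πδ + μ`, which gives (ii).

The geometric input is the smoothness of `p` with `p + p'' > 0` (`supportFn_regular`), the area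
formula `A = ½ ∫ p (p + p'')` (`area_eq`), and Bonnesen's inequality (`bonnesen`), proved by a
Wirtinger inequality. -/

/-! ### Polar angles and smooth angle lifts. -/

theorem exists_polar (a b : ℝ) :
    ∃ θ : ℝ, a = √(a ^ 2 + b ^ 2) * cos θ ∧ b = √(a ^ 2 + b ^ 2) * sin θ := by
  refine ⟨Complex.arg ⟨a, b⟩, ?_, ?_⟩
  · have h := Complex.norm_mul_cos_arg ⟨a, b⟩
    rw [Complex.norm_eq_sqrt_sq_add_sq] at h
    exact h.symm
  · have h := Complex.norm_mul_sin_arg ⟨a, b⟩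
    rw [Complex.norm_eq_sqrt_sq_add_sq] at h
    exact h.symm

/-- A periodic smooth planar vector field along `ℝ` that turns counterclockwise has a smooth,
surjective, increasing angle function. -/
theorem exists_angle_lift {a b : ℝ → ℝ} {T : ℝ} (hT : 0 < T) (ha : ContDiff ℝ ∞ a)
    (hb : ContDiff ℝ ∞ b) (hpa : Function.Periodic a T) (hpb : Function.Periodic b T)
    (hpos : ∀ t, 0 < a t * deriv b t - b t * deriv a t) :
    ∃ φ f : ℝ → ℝ, ContDiff ℝ ∞ φ ∧ (∀ t, HasDerivAt φ (f t) t) ∧ (∀ t, 0 < f t) ∧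
      Function.Surjective φ ∧ ∀ t, 0 < √(a t ^ 2 + b t ^ 2) ∧
        a t = -(√(a t ^ 2 + b t ^ 2) * sin (φ t)) ∧ b t = √(a t ^ 2 + b t ^ 2) * cos (φ t) := by
  have hda : ∀ t, HasDerivAt a (deriv a t) t := fun t =>
    ((ha.differentiable (by simp)) t).hasDerivAt
  have hdb : ∀ t, HasDerivAt b (deriv b t) t := fun t =>
    ((hb.differentiable (by simp)) t).hasDerivAt
  have ha' : ContDiff ℝ ∞ (deriv a) := (contDiff_infty_iff_deriv.1 ha).2
  have hb' : ContDiff ℝ ∞ (deriv b) := (contDiff_infty_iff_deriv.1 hb).2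
  have hn : ∀ t, 0 < a t ^ 2 + b t ^ 2 := by
    intro t
    by_contra h
    have h1 : a t = 0 := by nlinarith [sq_nonneg (a t), sq_nonneg (b t)]
    have h2 : b t = 0 := by nlinarith [sq_nonneg (a t), sq_nonneg (b t)]
    have := hpos t
    simp [h1, h2] at this
  -- `f` is the angular speed of `(a, b)`; its primitive `φ` is the angle of the vector turned
  -- clockwise by a right angle, that is, of the outward normal when `(a, b)` is a counterclockwise
  -- tangent.
  set f : ℝ → ℝ := fun t => (a t * deriv b t - b t * deriv a t) / (a t ^ 2 + b t ^ 2) with hf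
  have hfpos : ∀ t, 0 < f t := fun t => div_pos (hpos t) (hn t)
  have hfs : ContDiff ℝ ∞ f :=
    ((ha.mul hb').sub (hb.mul ha')).div ((ha.pow 2).add (hb.pow 2)) fun t => (hn t).ne'
  have hpf : Function.Periodic f T := by
    intro t
    have e1 : deriv a (t + T) = deriv a t := by
      rw [← deriv_comp_add_const]; congr 1; funext s; exact hpa s
    have e2 : deriv b (t + T) = deriv b t := by
      rw [← deriv_comp_add_const]; congr 1; funext s; exact hpb s
    simp only [hf, e1, e2, hpa t, hpb t]
  obtain ⟨φ₀, hφc, hφs⟩ := exists_polar (b 0) (-(a 0))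
  have en : b 0 ^ 2 + (-(a 0)) ^ 2 = a 0 ^ 2 + b 0 ^ 2 := by ring
  rw [en] at hφc hφs
  set φ : ℝ → ℝ := fun t => φ₀ + ∫ s in (0 : ℝ)..t, f s with hφ
  have hint : ∀ c d, IntervalIntegrable f volume c d := fun c d =>
    hfs.continuous.intervalIntegrable c d
  have hdφ : ∀ t, HasDerivAt φ (f t) t := fun t =>
    (intervalIntegral.integral_hasDerivAt_right (hint 0 t)
      (hfs.continuous.stronglyMeasurableAtFilter _ _) hfs.continuous.continuousAt).const_add φ₀
  have hφsm : ContDiff ℝ ∞ φ := by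
    refine contDiff_infty_iff_deriv.2 ⟨fun t => (hdφ t).differentiableAt, ?_⟩
    rw [show deriv φ = f from funext fun t => (hdφ t).deriv]
    exact hfs
  have hsurj : Function.Surjective φ := by
    refine hφsm.continuous.surjective ?_ ?_
    · exact Filter.tendsto_atTop_add_const_left _ _
        (hpf.tendsto_atTop_intervalIntegral_of_pos' (hint 0 T) hfpos hT)
    · exact Filter.tendsto_atBot_add_const_left _ _
        (hpf.tendsto_atBot_intervalIntegral_of_pos' (hint 0 T) hfpos hT)
  refine ⟨φ, f, hφsm, hdφ, hfpos, hsurj, ?_⟩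
  set N : ℝ → ℝ := fun t => √(a t ^ 2 + b t ^ 2) with hN
  have hNpos : ∀ t, 0 < N t := fun t => sqrt_pos.2 (hn t)
  have hNsq : ∀ t, N t ^ 2 = a t ^ 2 + b t ^ 2 := fun t => sq_sqrt (hn t).le
  -- This is the inner product of the unit vectors along `(a, b)` and `(-sin φ, cos φ)`. Both rotate
  -- with angular speed `f`, so it is constant; it is `1` at `0` by the choice of `φ₀`.
  have hder : ∀ t, HasDerivAt (fun t => (-(a t * sin (φ t)) + b t * cos (φ t)) / N t) 0 t := by
    intro t
    have h1 := ((hda t).mul (hdφ t).sin).neg.add ((hdb t).mul (hdφ t).cos)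
    have h2 := (((hda t).pow 2).add ((hdb t).pow 2)).sqrt (hn t).ne'
    have h3 := h1.div h2 (hNpos t).ne'
    refine h3.congr_deriv ?_
    have e0 := hNsq t
    have e1 := (hNpos t).ne'
    have e2 := (hn t).ne'
    rw [div_eq_zero_iff]
    left
    have e3 : √((a ^ 2 + b ^ 2) t) = N t := rfl
    simp only [Pi.add_apply, Pi.neg_apply, Pi.mul_apply, e3, hf] at *
    field_simp
    rw [e0]
    push_cast
    ring
  have hconst : ∀ t, (-(a t * sin (φ t)) + b t * cos (φ t)) / N t = 1 := by
    intro t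
    rw [is_const_of_deriv_eq_zero (fun t => (hder t).differentiableAt) (fun t => (hder t).deriv)
      t 0, div_eq_one_iff_eq (hNpos 0).ne']
    have e0 := hNsq 0
    have : φ 0 = φ₀ := by simp [hφ]
    rw [this]
    have h1 : b 0 = N 0 * cos φ₀ := hφc
    have h2 : -a 0 = N 0 * sin φ₀ := hφs
    have h3 := sin_sq_add_cos_sq φ₀
    linear_combination cos φ₀ * h1 + sin φ₀ * h2 + N 0 * h3
  intro t
  have h1 := (div_eq_one_iff_eq (hNpos t).ne').1 (hconst t)
  have h2 := hNsq t
  have h3 := sin_sq_add_cos_sq (φ t)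
  have h4 : a t * cos (φ t) + b t * sin (φ t) = 0 := by
    have : (a t * cos (φ t) + b t * sin (φ t)) ^ 2 = 0 := by
      linear_combination (a t ^ 2 + b t ^ 2) * h3 - h2 -
        (-(a t * sin (φ t)) + b t * cos (φ t) + N t) * h1
    exact pow_eq_zero_iff (two_ne_zero) |>.1 this
  refine ⟨hNpos t, ?_, ?_⟩
  · change a t = -(N t * sin (φ t))
    linear_combination cos (φ t) * h4 - sin (φ t) * h1 - a t * h3
  · change b t = N t * cos (φ t)
    linear_combination sin (φ t) * h4 + cos (φ t) * h1 - b t * h3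

/-! ### Support functions and supporting lines. -/

theorem inner_unitVec (x : Plane) (θ : ℝ) :
    inner ℝ x (unitVec θ) = x 0 * cos θ + x 1 * sin θ := by
  simp [unitVec, PiLp.inner_apply, Fin.sum_univ_two, mul_comm]

theorem bddAbove_inner_unitVec {K : Set Plane} (hK : IsCompact K) (θ : ℝ) :
    BddAbove ((fun x : Plane => inner ℝ x (unitVec θ)) '' K) :=
  (hK.image (by fun_prop)).bddAbove

theorem inner_le_supportFn {K : Set Plane} (hK : IsCompact K) {x : Plane} (hx : x ∈ K) (θ : ℝ) :
    x 0 * cos θ + x 1 * sin θ ≤ supportFn K θ := by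
  rw [← inner_unitVec]
  exact le_csSup (bddAbove_inner_unitVec hK θ) ⟨x, hx, rfl⟩

theorem supportFn_le {K : Set Plane} (hne : K.Nonempty) {θ s : ℝ}
    (h : ∀ x ∈ K, x 0 * cos θ + x 1 * sin θ ≤ s) : supportFn K θ ≤ s := by
  refine csSup_le (hne.image _) ?_
  rintro _ ⟨x, hx, rfl⟩
  simpa only [inner_unitVec] using h x hx

theorem unitVec_congr {θ θ' : ℝ} (hc : cos θ = cos θ') (hs : sin θ = sin θ') :
    unitVec θ = unitVec θ' := by
  simp [unitVec, hc, hs]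

theorem supportFn_congr (K : Set Plane) {θ θ' : ℝ} (hc : cos θ = cos θ') (hs : sin θ = sin θ') :
    supportFn K θ = supportFn K θ' := by
  simp only [supportFn, unitVec_congr hc hs]

theorem supportFn_periodic (K : Set Plane) : Function.Periodic (supportFn K) (2 * π) := fun θ =>
  supportFn_congr K (cos_add_two_pi θ) (sin_add_two_pi θ)

/-- Every nonzero linear functional on the plane is a positive multiple of a unit normal. -/
theorem exists_normal (f : StrongDual ℝ Plane) (hf : f ≠ 0) :
    ∃ r θ : ℝ, 0 < r ∧ ∀ x : Plane, f x = r * (x 0 * cos θ + x 1 * sin θ) := by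
  set e : Fin 2 → Plane := fun i => EuclideanSpace.single i 1 with he
  have hfx : ∀ x : Plane, f x = x 0 * f (e 0) + x 1 * f (e 1) := by
    intro x
    have : x = x 0 • e 0 + x 1 • e 1 := by
      ext i; fin_cases i <;> simp [he]
    conv_lhs => rw [this]
    simp
  obtain ⟨θ, h0, h1⟩ := exists_polar (f (e 0)) (f (e 1))
  refine ⟨√(f (e 0) ^ 2 + f (e 1) ^ 2), θ, ?_, ?_⟩
  · refine lt_of_le_of_ne (sqrt_nonneg _) fun h => hf ?_
    rw [← h] at h0 h1
    ext x
    rw [hfx, h0, h1]; simp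
  · intro x
    rw [hfx]
    linear_combination x 0 * h0 + x 1 * h1

/-- A compact convex set is the intersection of its supporting half-planes. -/
theorem mem_iff_forall_le_supportFn {K : Set Plane} (hK : IsCompact K) (hc : Convex ℝ K)
    (hne : K.Nonempty) (x : Plane) :
    x ∈ K ↔ ∀ θ, x 0 * cos θ + x 1 * sin θ ≤ supportFn K θ := by
  refine ⟨fun hx θ => inner_le_supportFn hK hx θ, fun h => ?_⟩
  by_contra hx
  obtain ⟨f, v, hf, hv⟩ := geometric_hahn_banach_closed_point hc hK.isClosed hx
  obtain ⟨y, hy⟩ := hne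
  have hf0 : f ≠ 0 := by
    rintro rfl
    have := hf y hy
    simp at this hv
    linarith
  obtain ⟨r, θ, hr, hrf⟩ := exists_normal f hf0
  have h1 : supportFn K θ ≤ v / r := by
    refine supportFn_le ⟨y, hy⟩ fun z hz => ?_
    rw [le_div_iff₀' hr, ← hrf]
    exact (hf z hz).le
  have h2 := (h θ).trans h1
  rw [le_div_iff₀' hr, ← hrf] at h2
  linarith

/-- Every boundary point of a convex body has a supporting line. -/
theorem exists_supporting_normal {K : Set Plane} (hK : IsCompact K) (hc : Convex ℝ K)
    (hint : (interior K).Nonempty) {x : Plane} (hx : x ∈ frontier K) :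
    ∃ θ, x 0 * cos θ + x 1 * sin θ = supportFn K θ := by
  have hxK : x ∈ K := hK.isClosed.frontier_subset hx
  obtain ⟨f, hf⟩ := geometric_hahn_banach_open_point hc.interior isOpen_interior hx.2
  obtain ⟨y, hy⟩ := hint
  have hf0 : f ≠ 0 := by
    rintro rfl
    simpa using hf y hy
  have hle : ∀ z ∈ K, f z ≤ f x := by
    intro z hz
    have : z ∈ closure (interior K) := by
      rw [hc.closure_interior_eq_closure_of_nonempty_interior ⟨y, hy⟩]
      exact subset_closure hz
    exact closure_minimal (fun w hw => (hf w hw).le) (isClosed_Iic.preimage f.continuous) this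
  obtain ⟨r, θ, hr, hrf⟩ := exists_normal f hf0
  refine ⟨θ, le_antisymm (inner_le_supportFn hK hxK θ) (supportFn_le ⟨x, hxK⟩ fun z hz => ?_)⟩
  have := hle z hz
  rw [hrf, hrf] at this
  exact le_of_mul_le_mul_left this hr

/-! ### Regularity of the support function. -/

theorem hasDerivAt_plane_iff {c : ℝ → Plane} {v : Plane} {t : ℝ} :
    HasDerivAt c v t ↔
      HasDerivAt (fun s => c s 0) (v 0) t ∧ HasDerivAt (fun s => c s 1) (v 1) t := by
  rw [hasDerivAt_iff_hasFDerivAt, ← hasFDerivWithinAt_univ, hasFDerivWithinAt_euclidean,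
    Fin.forall_fin_two]
  refine and_congr ?_ ?_ <;>
  · rw [hasDerivAt_iff_hasFDerivAt, hasFDerivWithinAt_univ]
    refine iff_of_eq (congrArg (fun L => HasFDerivAt _ L t) ?_)
    ext
    simp

/-- At a parameter where a counterclockwise curved arc touches its supporting line from inside,
the velocity points in the positive tangent direction of that line. -/
theorem tangent_at_support {a b : ℝ → ℝ} (ha : ContDiff ℝ ∞ a) (hb : ContDiff ℝ ∞ b) {θ t : ℝ}
    (hmax : ∀ s, a s * cos θ + b s * sin θ ≤ a t * cos θ + b t * sin θ)
    (hpos : 0 < deriv a t * deriv (deriv b) t - deriv b t * deriv (deriv a) t) :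
    deriv a t = -(√(deriv a t ^ 2 + deriv b t ^ 2) * sin θ) ∧
      deriv b t = √(deriv a t ^ 2 + deriv b t ^ 2) * cos θ := by
  have ha' : ContDiff ℝ ∞ (deriv a) := (contDiff_infty_iff_deriv.1 ha).2
  have hb' : ContDiff ℝ ∞ (deriv b) := (contDiff_infty_iff_deriv.1 hb).2
  have d1 : ∀ s, HasDerivAt (fun s => a s * cos θ + b s * sin θ)
      (deriv a s * cos θ + deriv b s * sin θ) s := fun s =>
    (((ha.differentiable (by simp)) s).hasDerivAt.mul_const _).add
      (((hb.differentiable (by simp)) s).hasDerivAt.mul_const _)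
  have d2 : ∀ s, HasDerivAt (fun s => deriv a s * cos θ + deriv b s * sin θ)
      (deriv (deriv a) s * cos θ + deriv (deriv b) s * sin θ) s := fun s =>
    (((ha'.differentiable (by simp)) s).hasDerivAt.mul_const _).add
      (((hb'.differentiable (by simp)) s).hasDerivAt.mul_const _)
  have e1 : deriv (fun s => a s * cos θ + b s * sin θ) =
      fun s => deriv a s * cos θ + deriv b s * sin θ := funext fun s => (d1 s).deriv
  have hlm : IsLocalMax (fun s => a s * cos θ + b s * sin θ) t :=
    Filter.Eventually.of_forall hmax
  have h1 : deriv a t * cos θ + deriv b t * sin θ = 0 := hlm.hasDerivAt_eq_zero (d1 t)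
  -- If the second derivative were positive, the maximum would also be a local minimum, so the
  -- function would be locally constant and its second derivative zero.
  have h2 : deriv (deriv a) t * cos θ + deriv (deriv b) t * sin θ ≤ 0 := by
    by_contra! h
    have hmin : IsLocalMin (fun s => a s * cos θ + b s * sin θ) t := by
      refine isLocalMin_of_deriv_deriv_pos ?_ ?_ (d1 t).continuousAt
      · rw [e1, (d2 t).deriv]; exact h
      · rw [e1]; exact h1
    have hev : (fun s => a s * cos θ + b s * sin θ) =ᶠ[nhds t]
        fun _ => a t * cos θ + b t * sin θ :=
      hmin.mono fun s hs => le_antisymm (hmax s) hs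
    have h3 := hev.deriv.deriv_eq
    rw [e1, (d2 t).deriv] at h3
    simp at h3
    linarith
  set A := deriv a t
  set B := deriv b t
  set s := -(A * sin θ) + B * cos θ with hs
  have h3 := sin_sq_add_cos_sq θ
  have hA : A = -(s * sin θ) := by rw [hs]; linear_combination cos θ * h1 - A * h3
  have hB : B = s * cos θ := by rw [hs]; linear_combination sin θ * h1 - B * h3
  have hspos : 0 < s := by
    by_contra! h
    have : A * deriv (deriv b) t - B * deriv (deriv a) t =
        -(s * (deriv (deriv a) t * cos θ + deriv (deriv b) t * sin θ)) := by
      linear_combination deriv (deriv b) t * hA - deriv (deriv a) t * hB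
    nlinarith
  have hN : √(A ^ 2 + B ^ 2) = s := by
    rw [show A ^ 2 + B ^ 2 = s ^ 2 by
      linear_combination (A - s * sin θ) * hA + (B + s * cos θ) * hB + s ^ 2 * h3]
    exact sqrt_sq hspos.le
  rw [hN]
  exact ⟨hA, hB⟩

/-- The support function of a smooth strictly convex domain is smooth with positive radius of
curvature `p + p''`, and `boundaryCurve` runs in the domain. -/
theorem IsSmoothStrictlyConvexDomain.supportFn_regular {K : Set Plane}
    (hK : IsSmoothStrictlyConvexDomain K) :
    ContDiff ℝ ∞ (supportFn K) ∧
      (∀ θ, 0 < supportFn K θ + deriv (deriv (supportFn K)) θ) ∧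
      ∀ θ, boundaryCurve K θ ∈ K := by
  obtain ⟨c, T, hT, hc, hper, -, -, hcurv, hrange⟩ := hK.boundary
  have hconv := hK.strictConvex.convex
  set a : ℝ → ℝ := fun t => c t 0 with ha_def
  set b : ℝ → ℝ := fun t => c t 1 with hb_def
  have ha : ContDiff ℝ ∞ a := contDiff_euclidean.1 hc 0
  have hb : ContDiff ℝ ∞ b := contDiff_euclidean.1 hc 1
  have ha' : ContDiff ℝ ∞ (deriv a) := (contDiff_infty_iff_deriv.1 ha).2
  have hb' : ContDiff ℝ ∞ (deriv b) := (contDiff_infty_iff_deriv.1 hb).2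
  have hc' : ContDiff ℝ ∞ (deriv c) := (contDiff_infty_iff_deriv.1 hc).2
  have hdc : ∀ t, HasDerivAt c (deriv c t) t := fun t =>
    ((hc.differentiable (by simp)) t).hasDerivAt
  have hdc' : ∀ t, HasDerivAt (deriv c) (deriv (deriv c) t) t := fun t =>
    ((hc'.differentiable (by simp)) t).hasDerivAt
  have ea : deriv a = fun t => deriv c t 0 :=
    funext fun t => (hasDerivAt_plane_iff.1 (hdc t)).1.deriv
  have eb : deriv b = fun t => deriv c t 1 :=
    funext fun t => (hasDerivAt_plane_iff.1 (hdc t)).2.deriv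
  have eaa : ∀ t, deriv (deriv a) t = deriv (deriv c) t 0 := fun t => by
    rw [ea]; exact (hasDerivAt_plane_iff.1 (hdc' t)).1.deriv
  have ebb : ∀ t, deriv (deriv b) t = deriv (deriv c) t 1 := fun t => by
    rw [eb]; exact (hasDerivAt_plane_iff.1 (hdc' t)).2.deriv
  have hpos : ∀ t, 0 < deriv a t * deriv (deriv b) t - deriv b t * deriv (deriv a) t := by
    intro t
    have h := hcurv t
    unfold curveCurvature planeCross at h
    rw [eaa, ebb, ea, eb]
    by_contra! hle
    exact absurd h (not_lt.2 (div_nonpos_of_nonpos_of_nonneg hle (by positivity)))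
  have hpa : Function.Periodic (deriv a) T := fun t => by
    rw [← deriv_comp_add_const]; congr 1; funext s; simp only [ha_def, hper s]
  have hpb : Function.Periodic (deriv b) T := fun t => by
    rw [← deriv_comp_add_const]; congr 1; funext s; simp only [hb_def, hper s]
  obtain ⟨φ, f, hφ, hdφ, hf, hsurj, hlift⟩ := exists_angle_lift hT ha' hb' hpa hpb hpos
  have hmem : ∀ t, c t ∈ K := fun t =>
    hK.isCompact.isClosed.frontier_subset (hrange ▸ Set.mem_range_self t)
  -- The boundary point `c t` has some outward normal `θ`. The velocity determines that normal, so
  -- `θ` and `φ t` agree modulo `2π`.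
  have hsupp : ∀ t, supportFn K (φ t) = a t * cos (φ t) + b t * sin (φ t) := by
    intro t
    obtain ⟨θ, hθ⟩ := exists_supporting_normal hK.isCompact hconv hK.nonempty_interior
      (hrange ▸ Set.mem_range_self t : c t ∈ frontier K)
    obtain ⟨h1, h2⟩ := tangent_at_support ha hb (θ := θ) (t := t)
      (fun s => by
        have := inner_le_supportFn hK.isCompact (hmem s) θ
        rw [← hθ] at this
        exact this) (hpos t)
    obtain ⟨h0, h3, h4⟩ := hlift t
    have hs : sin θ = sin (φ t) := by
      have : √(deriv a t ^ 2 + deriv b t ^ 2) * sin θ =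
        √(deriv a t ^ 2 + deriv b t ^ 2) * sin (φ t) := by linarith
      exact mul_left_cancel₀ h0.ne' this
    have hc : cos θ = cos (φ t) := by
      have : √(deriv a t ^ 2 + deriv b t ^ 2) * cos θ =
        √(deriv a t ^ 2 + deriv b t ^ 2) * cos (φ t) := by linarith
      exact mul_left_cancel₀ h0.ne' this
    rw [supportFn_congr K hc.symm hs.symm, ← hs, ← hc]
    exact hθ.symm
  have hmono : StrictMono φ := strictMono_of_hasDerivAt_pos hdφ hf
  set e : ℝ ≃ₜ ℝ := (hmono.orderIsoOfSurjective φ hsurj).toHomeomorph with he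
  have heφ : ⇑e = φ := rfl
  -- Inverting the normal angle gives a global reparametrization by `θ`, smooth because `φ' > 0`.
  set τ : ℝ → ℝ := ⇑e.symm with hτ
  have hτφ : ∀ θ, φ (τ θ) = θ := fun θ => e.apply_symm_apply θ
  have hτs : ContDiff ℝ ∞ τ :=
    e.contDiff_symm_deriv (fun t => (hf t).ne') (fun t => by rw [heφ]; exact hdφ t)
      (by rw [heφ]; exact hφ)
  have hdτ : ∀ θ, HasDerivAt τ (f (τ θ))⁻¹ θ := fun θ =>
    HasDerivAt.of_local_left_inverse hτs.continuous.continuousAt (hdφ (τ θ)) (hf _).ne'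
      (Filter.Eventually.of_forall hτφ)
  have hp : supportFn K = fun θ => a (τ θ) * cos θ + b (τ θ) * sin θ := by
    funext θ
    have := hsupp (τ θ)
    rwa [hτφ] at this
  have hda : ∀ θ, HasDerivAt (fun θ => a (τ θ)) (deriv a (τ θ) * (f (τ θ))⁻¹) θ := fun θ =>
    ((ha.differentiable (by simp)) (τ θ)).hasDerivAt.comp θ (hdτ θ)
  have hdb : ∀ θ, HasDerivAt (fun θ => b (τ θ)) (deriv b (τ θ) * (f (τ θ))⁻¹) θ := fun θ =>
    ((hb.differentiable (by simp)) (τ θ)).hasDerivAt.comp θ (hdτ θ)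
  have hlift' : ∀ θ, 0 < √(deriv a (τ θ) ^ 2 + deriv b (τ θ) ^ 2) ∧
      deriv a (τ θ) = -(√(deriv a (τ θ) ^ 2 + deriv b (τ θ) ^ 2) * sin θ) ∧
      deriv b (τ θ) = √(deriv a (τ θ) ^ 2 + deriv b (τ θ) ^ 2) * cos θ := fun θ => by
    have := hlift (τ θ)
    rwa [hτφ] at this
  -- The terms containing `τ'` cancel, since the velocity is orthogonal to the normal.
  -- Differentiating once more gives `p + p'' = |c'| / f`.
  have hp1 : deriv (supportFn K) = fun θ => -(a (τ θ) * sin θ) + b (τ θ) * cos θ := by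
    funext θ
    rw [hp]
    refine (((hda θ).mul (hasDerivAt_cos θ)).add ((hdb θ).mul (hasDerivAt_sin θ))).deriv.trans ?_
    obtain ⟨-, h1, h2⟩ := hlift' θ
    linear_combination (f (τ θ))⁻¹ * (cos θ * h1 + sin θ * h2)
  refine ⟨?_, ?_, ?_⟩
  · rw [hp]
    exact ((ha.comp hτs).mul contDiff_cos).add ((hb.comp hτs).mul contDiff_sin)
  · intro θ
    have h2 := (((hda θ).mul (hasDerivAt_sin θ)).neg.add
      ((hdb θ).mul (hasDerivAt_cos θ))).deriv
    rw [← show deriv (supportFn K) = -((fun θ => a (τ θ)) * sin) + (fun θ => b (τ θ)) * cos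
      from hp1] at h2
    rw [h2, congrFun hp θ]
    obtain ⟨h0, h3, h4⟩ := hlift' θ
    have h5 := sin_sq_add_cos_sq θ
    have h6 : 0 < √(deriv a (τ θ) ^ 2 + deriv b (τ θ) ^ 2) * (f (τ θ))⁻¹ :=
      mul_pos h0 (inv_pos.2 (hf _))
    refine h6.trans_eq ?_
    linear_combination (f (τ θ))⁻¹ * (sin θ * h3 - cos θ * h4) -
      (√(deriv a (τ θ) ^ 2 + deriv b (τ θ) ^ 2) * (f (τ θ))⁻¹) * h5
  · intro θ
    have : boundaryCurve K θ = c (τ θ) := by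
      have h5 := sin_sq_add_cos_sq θ
      ext i
      fin_cases i
      · simp only [boundaryCurve, congrFun hp1 θ, congrFun hp θ, Fin.zero_eta, PiLp.toLp_apply, Matrix.cons_val_zero]
        change _ = a (τ θ)
        linear_combination a (τ θ) * h5
      · simp only [boundaryCurve, congrFun hp1 θ, congrFun hp θ, Fin.mk_one, PiLp.toLp_apply,
          Matrix.cons_val_one, Matrix.cons_val_fin_one]
        change _ = b (τ θ)
        linear_combination b (τ θ) * h5
    rw [this]
    exact hmem _

/-! ### Curvature, length and the locus of centers in terms of the support function. -/

theorem ContDiff.hasDerivAt_deriv {f : ℝ → ℝ} (hf : ContDiff ℝ ∞ f) (x : ℝ) :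
    HasDerivAt f (deriv f x) x :=
  ((hf.differentiable (by simp)) x).hasDerivAt

theorem ContDiff.deriv_infty {f : ℝ → ℝ} (hf : ContDiff ℝ ∞ f) : ContDiff ℝ ∞ (deriv f) :=
  (contDiff_infty_iff_deriv.1 hf).2

theorem Function.Periodic.deriv_periodic {f : ℝ → ℝ} {T : ℝ} (hf : Function.Periodic f T) :
    Function.Periodic (deriv f) T := fun t => by
  rw [← deriv_comp_add_const]; congr 1; funext s; exact hf s

/-- The function `p + p''`, which is the radius of curvature at normal angle `θ`. -/
noncomputable def radiusFn (p : ℝ → ℝ) (θ : ℝ) : ℝ := p θ + deriv (deriv p) θ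

theorem ContDiff.radiusFn {p : ℝ → ℝ} (hp : ContDiff ℝ ∞ p) : ContDiff ℝ ∞ (radiusFn p) :=
  hp.add hp.deriv_infty.deriv_infty

theorem Function.Periodic.radiusFn {p : ℝ → ℝ} {T : ℝ} (hp : Function.Periodic p T) :
    Function.Periodic (radiusFn p) T := fun t => by
  simp only [_root_.radiusFn, hp t, hp.deriv_periodic.deriv_periodic t]

theorem deriv_radiusFn {p : ℝ → ℝ} (hp : ContDiff ℝ ∞ p) (θ : ℝ) :
    deriv (radiusFn p) θ = deriv p θ + deriv (deriv (deriv p)) θ :=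
  ((hp.hasDerivAt_deriv θ).add (hp.deriv_infty.deriv_infty.hasDerivAt_deriv θ)).deriv

theorem norm_plane (x y : ℝ) : ‖(!₂[x, y] : Plane)‖ = √(x ^ 2 + y ^ 2) := by
  simp [EuclideanSpace.norm_eq, Fin.sum_univ_two]

section

variable {K : Set Plane}

theorem deriv_boundaryCurve (hp : ContDiff ℝ ∞ (supportFn K)) :
    deriv (boundaryCurve K) = fun θ =>
      !₂[-(radiusFn (supportFn K) θ * sin θ), radiusFn (supportFn K) θ * cos θ] := by
  funext θ
  refine HasDerivAt.deriv (hasDerivAt_plane_iff.2 ⟨?_, ?_⟩)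
  · refine (((hp.hasDerivAt_deriv θ).mul (hasDerivAt_cos θ)).sub
      ((hp.deriv_infty.hasDerivAt_deriv θ).mul (hasDerivAt_sin θ))).congr_deriv ?_
    simp [radiusFn]; ring
  · refine (((hp.hasDerivAt_deriv θ).mul (hasDerivAt_sin θ)).add
      ((hp.deriv_infty.hasDerivAt_deriv θ).mul (hasDerivAt_cos θ))).congr_deriv ?_
    simp [radiusFn]; ring

theorem norm_deriv_boundaryCurve (hp : ContDiff ℝ ∞ (supportFn K))
    (hρ : ∀ θ, 0 < radiusFn (supportFn K) θ) (θ : ℝ) :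
    ‖deriv (boundaryCurve K) θ‖ = radiusFn (supportFn K) θ := by
  rw [deriv_boundaryCurve hp, norm_plane]
  have h := sin_sq_add_cos_sq θ
  rw [show (-(radiusFn (supportFn K) θ * sin θ)) ^ 2 + (radiusFn (supportFn K) θ * cos θ) ^ 2 =
    radiusFn (supportFn K) θ ^ 2 by linear_combination radiusFn (supportFn K) θ ^ 2 * h]
  exact sqrt_sq (hρ θ).le

theorem curvatureRadius_eq (hp : ContDiff ℝ ∞ (supportFn K))
    (hρ : ∀ θ, 0 < radiusFn (supportFn K) θ) (θ : ℝ) :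
    curvatureRadius K θ = radiusFn (supportFn K) θ := by
  have hR := hp.radiusFn
  have h2 : deriv (deriv (boundaryCurve K)) θ =
      !₂[-(deriv (radiusFn (supportFn K)) θ * sin θ + radiusFn (supportFn K) θ * cos θ),
        deriv (radiusFn (supportFn K)) θ * cos θ - radiusFn (supportFn K) θ * sin θ] := by
    rw [deriv_boundaryCurve hp]
    refine HasDerivAt.deriv (hasDerivAt_plane_iff.2 ⟨?_, ?_⟩)
    · exact ((hR.hasDerivAt_deriv θ).mul (hasDerivAt_sin θ)).neg
    · refine ((hR.hasDerivAt_deriv θ).mul (hasDerivAt_cos θ)).congr_deriv ?_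
      simp; ring
  have h0 := (hρ θ).ne'
  have h := sin_sq_add_cos_sq θ
  have hc : planeCross (deriv (boundaryCurve K) θ) (deriv (deriv (boundaryCurve K)) θ) =
      radiusFn (supportFn K) θ ^ 2 := by
    rw [h2, deriv_boundaryCurve hp]
    simp only [planeCross, Matrix.cons_val_zero, Matrix.cons_val_one,
      Matrix.cons_val_fin_one]
    linear_combination radiusFn (supportFn K) θ ^ 2 * h
  rw [curvatureRadius, curvature, curveCurvature, hc, norm_deriv_boundaryCurve hp hρ]
  field_simp

theorem perimeter_eq_integral_radiusFn (hp : ContDiff ℝ ∞ (supportFn K))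
    (hρ : ∀ θ, 0 < radiusFn (supportFn K) θ) :
    perimeter K = ∫ θ in (0 : ℝ)..(2 * π), radiusFn (supportFn K) θ :=
  intervalIntegral.integral_congr fun θ _ => norm_deriv_boundaryCurve hp hρ θ

theorem curvatureSqIntegral_nonneg : 0 ≤ curvatureSqIntegral K :=
  intervalIntegral.integral_nonneg (by positivity) fun θ _ => by positivity

theorem centerLocus_eq (hp : ContDiff ℝ ∞ (supportFn K))
    (hρ : ∀ θ, 0 < radiusFn (supportFn K) θ) :
    centerLocus K = fun θ =>
      !₂[-(deriv (deriv (supportFn K)) θ * cos θ) - deriv (supportFn K) θ * sin θ,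
        -(deriv (deriv (supportFn K)) θ * sin θ) + deriv (supportFn K) θ * cos θ] := by
  funext θ
  rw [centerLocus, curvatureRadius_eq hp hρ]
  ext i
  fin_cases i
  · simp [boundaryCurve, unitVec, radiusFn]; ring
  · simp [boundaryCurve, unitVec, radiusFn]; ring

theorem deriv_centerLocus (hp : ContDiff ℝ ∞ (supportFn K))
    (hρ : ∀ θ, 0 < radiusFn (supportFn K) θ) :
    deriv (centerLocus K) = fun θ =>
      !₂[-(deriv (radiusFn (supportFn K)) θ * cos θ),
        -(deriv (radiusFn (supportFn K)) θ * sin θ)] := by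
  funext θ
  have d1 := hp.deriv_infty.hasDerivAt_deriv θ
  have d2 := hp.deriv_infty.deriv_infty.hasDerivAt_deriv θ
  rw [centerLocus_eq hp hρ]
  refine HasDerivAt.deriv (hasDerivAt_plane_iff.2 ⟨?_, ?_⟩)
  · refine ((d2.mul (hasDerivAt_cos θ)).neg.sub (d1.mul (hasDerivAt_sin θ))).congr_deriv ?_
    simp [deriv_radiusFn hp]; ring
  · refine ((d2.mul (hasDerivAt_sin θ)).neg.add (d1.mul (hasDerivAt_cos θ))).congr_deriv ?_
    simp [deriv_radiusFn hp]; ring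

theorem orientedAreaLocus_eq (hp : ContDiff ℝ ∞ (supportFn K))
    (hρ : ∀ θ, 0 < radiusFn (supportFn K) θ) :
    orientedAreaLocus K = (1 / 2) * ∫ θ in (0 : ℝ)..(2 * π),
      deriv (supportFn K) θ * deriv (radiusFn (supportFn K)) θ := by
  rw [orientedAreaLocus]
  congr 1
  refine intervalIntegral.integral_congr fun θ _ => ?_
  have h := sin_sq_add_cos_sq θ
  simp only [congrFun (deriv_centerLocus hp hρ) θ, congrFun (centerLocus_eq hp hρ) θ, planeCross, PiLp.toLp_apply,
    Matrix.cons_val_zero, Matrix.cons_val_one, Matrix.cons_val_fin_one]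
  linear_combination deriv (supportFn K) θ * deriv (radiusFn (supportFn K)) θ * h

/-- As `β' = -ρ' (cos θ, sin θ)`, the direction of `β'` turns at unit speed in `θ` and the speed is
`|ρ'|`. The default value `0` at singular points agrees with `ρ' = 0` there. -/
theorem locusCurvatureRadius_eq (hp : ContDiff ℝ ∞ (supportFn K))
    (hρ : ∀ θ, 0 < radiusFn (supportFn K) θ) (θ : ℝ) :
    locusCurvatureRadius K θ = |deriv (radiusFn (supportFn K)) θ| := by
  set r := deriv (radiusFn (supportFn K)) with hr
  have h := sin_sq_add_cos_sq θ
  have hn : ‖deriv (centerLocus K) θ‖ = |r θ| := by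
    rw [deriv_centerLocus hp hρ, norm_plane, ← sqrt_sq_eq_abs]
    congr 1
    linear_combination r θ ^ 2 * h
  unfold locusCurvatureRadius
  split_ifs with h0
  · rw [h0, norm_zero] at hn
    exact hn
  · have hr0 : |r θ| ≠ 0 := by rw [← hn]; exact norm_ne_zero_iff.2 h0
    have dr := hp.radiusFn.deriv_infty.hasDerivAt_deriv θ
    have h2 : deriv (deriv (centerLocus K)) θ =
        !₂[-(deriv r θ * cos θ) + r θ * sin θ, -(deriv r θ * sin θ) - r θ * cos θ] := by
      rw [deriv_centerLocus hp hρ]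
      refine HasDerivAt.deriv (hasDerivAt_plane_iff.2 ⟨?_, ?_⟩)
      · refine (dr.mul (hasDerivAt_cos θ)).neg.congr_deriv ?_
        simp [hr]; ring
      · refine (dr.mul (hasDerivAt_sin θ)).neg.congr_deriv ?_
        simp [hr]; ring
    have hc : planeCross (deriv (centerLocus K) θ) (deriv (deriv (centerLocus K)) θ) =
        |r θ| ^ 2 := by
      rw [h2, deriv_centerLocus hp hρ, sq_abs]
      simp only [planeCross, Matrix.cons_val_zero, Matrix.cons_val_one,
        Matrix.cons_val_fin_one]
      linear_combination r θ ^ 2 * h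
    rw [curveCurvature, hc, hn, show 1 / (|r θ| ^ 2 / |r θ| ^ 3) = |r θ| by field_simp, abs_abs]

end

/-! ### The area as an integral over the cone on the boundary. -/

/-- The Fréchet derivative of the cone map `(s, θ) ↦ s • (x θ, y θ)`. -/
noncomputable def coneFDeriv (x y x' y' : ℝ) (s : ℝ) : ℝ × ℝ →L[ℝ] ℝ × ℝ :=
  (Matrix.toLin (.finTwoProd ℝ) (.finTwoProd ℝ)
    !![x, s * x'; y, s * y']).toContinuousLinearMap

theorem hasFDerivAt_cone {x y x' y' : ℝ → ℝ} (hx : ∀ θ, HasDerivAt x (x' θ) θ)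
    (hy : ∀ θ, HasDerivAt y (y' θ) θ) (q : ℝ × ℝ) :
    HasFDerivAt (fun q : ℝ × ℝ => (q.1 * x q.2, q.1 * y q.2))
      (coneFDeriv (x q.2) (y q.2) (x' q.2) (y' q.2) q.1) q := by
  unfold coneFDeriv
  rw [Matrix.toLin_finTwoProd_toContinuousLinearMap]
  convert!
    HasFDerivAt.prodMk (𝕜 := ℝ)
      (hasFDerivAt_fst.mul ((hx q.2).comp_hasFDerivAt q hasFDerivAt_snd))
      (hasFDerivAt_fst.mul ((hy q.2).comp_hasFDerivAt q hasFDerivAt_snd)) using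
    2 <;>
  simp [smul_smul, add_comm]

theorem det_coneFDeriv (x y x' y' s : ℝ) :
    (coneFDeriv x y x' y' s).det = s * (x * y' - y * x') := by
  unfold coneFDeriv
  simp only [LinearMap.det_toContinuousLinearMap, LinearMap.det_toLin, Matrix.det_fin_two_of]
  ring

theorem sin_sub_eq_zero_cases {θ ψ : ℝ} (hθ : θ ∈ Set.Ico 0 (2 * π)) (hψ : ψ ∈ Set.Ico 0 (2 * π))
    (h : sin (θ - ψ) = 0) : θ = ψ ∨ cos θ = -cos ψ ∧ sin θ = -sin ψ := by
  obtain ⟨n, hn⟩ := sin_eq_zero_iff.1 h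
  have hpi := pi_pos
  have h1 : (-2 : ℝ) < n := by nlinarith [hθ.1, hψ.2]
  have h2 : (n : ℝ) < 2 := by nlinarith [hθ.2, hψ.1]
  have h1' : -2 < n := by exact_mod_cast h1
  have h2' : n < 2 := by exact_mod_cast h2
  have : n = -1 ∨ n = 0 ∨ n = 1 := by omega
  rcases this with rfl | rfl | rfl
  · right
    have : θ = ψ - π := by push_cast at hn; linarith
    rw [this]; simp [cos_sub_pi, sin_sub_pi]
  · left; push_cast at hn; linarith
  · right
    have : θ = ψ + π := by push_cast at hn; linarith
    rw [this]; simp [cos_add_pi, sin_add_pi]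

/-- Area of a planar convex body with the origin in its interior, through its support function. -/
theorem volume_real_of_support {g : ℝ → ℝ} (hg : ContDiff ℝ ∞ g)
    (hper : Function.Periodic g (2 * π)) (hpos : ∀ θ, 0 < g θ) (hr : ∀ θ, 0 < radiusFn g θ)
    (hG : ∀ θ ψ, (g θ * cos θ - deriv g θ * sin θ) * cos ψ +
      (g θ * sin θ + deriv g θ * cos θ) * sin ψ ≤ g ψ) :
    volume.real {z : ℝ × ℝ | ∀ θ, z.1 * cos θ + z.2 * sin θ ≤ g θ} =
      (1 / 2) * ∫ θ in (0 : ℝ)..(2 * π), g θ * radiusFn g θ := by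
  have hpi := pi_pos
  set x : ℝ → ℝ := fun θ => g θ * cos θ - deriv g θ * sin θ with hx
  set y : ℝ → ℝ := fun θ => g θ * sin θ + deriv g θ * cos θ with hy
  set B := {z : ℝ × ℝ | ∀ θ, z.1 * cos θ + z.2 * sin θ ≤ g θ} with hB
  have hdx : ∀ θ, HasDerivAt x (-(radiusFn g θ * sin θ)) θ := fun θ => by
    refine (((hg.hasDerivAt_deriv θ).mul (hasDerivAt_cos θ)).sub
      ((hg.deriv_infty.hasDerivAt_deriv θ).mul (hasDerivAt_sin θ))).congr_deriv ?_
    simp only [radiusFn]; ring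
  have hdy : ∀ θ, HasDerivAt y (radiusFn g θ * cos θ) θ := fun θ => by
    refine (((hg.hasDerivAt_deriv θ).mul (hasDerivAt_sin θ)).add
      ((hg.deriv_infty.hasDerivAt_deriv θ).mul (hasDerivAt_cos θ))).congr_deriv ?_
    simp only [radiusFn]; ring
  have hxy : ∀ θ, x θ * cos θ + y θ * sin θ = g θ := fun θ => by
    have := sin_sq_add_cos_sq θ
    simp only [hx, hy]
    linear_combination g θ * this
  -- The map `(s, θ) ↦ s γ(θ)` is a bijection from `(0, 1] × [0, 2π)` onto the body minus the
  -- origin, with Jacobian `s g ρ`; the factor `s` integrates to `1/2`.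
  set F : ℝ × ℝ → ℝ × ℝ := fun q => (q.1 * x q.2, q.1 * y q.2) with hF
  set S : Set (ℝ × ℝ) := Set.Ioc 0 1 ×ˢ Set.Ico 0 (2 * π) with hS
  have hSm : MeasurableSet S := measurableSet_Ioc.prod measurableSet_Ico
  have hinj : Set.InjOn F S := by
    rintro ⟨s, θ⟩ ⟨hs, hθ⟩ ⟨t, ψ⟩ ⟨ht, hψ⟩ h
    simp only [hF, Prod.mk.injEq] at h
    obtain ⟨h1, h2⟩ := h
    simp only at hs hθ ht hψ
    have hst : s = t := by
      have a1 : s * g θ ≤ t * g θ := by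
        have := mul_le_mul_of_nonneg_left (hG ψ θ) ht.1.le
        rw [← hxy θ]
        change t * (x ψ * cos θ + y ψ * sin θ) ≤ t * g θ at this
        rw [← hxy θ] at this
        linear_combination this + cos θ * h1 + sin θ * h2
      have a2 : t * g ψ ≤ s * g ψ := by
        have := mul_le_mul_of_nonneg_left (hG θ ψ) hs.1.le
        rw [← hxy ψ]
        change s * (x θ * cos ψ + y θ * sin ψ) ≤ s * g ψ at this
        rw [← hxy ψ] at this
        linear_combination this - cos ψ * h1 - sin ψ * h2
      exact le_antisymm (le_of_mul_le_mul_right a1 (hpos θ))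
        (le_of_mul_le_mul_right a2 (hpos ψ))
    subst hst
    have e1 : x θ = x ψ := mul_left_cancel₀ hs.1.ne' h1
    have e2 : y θ = y ψ := mul_left_cancel₀ hs.1.ne' h2
    -- The common boundary point maximizes the functional of normal `ψ`, so differentiating along
    -- the curve at `θ` forces `sin (θ - ψ) = 0`. Antipodal normals are excluded because `g > 0` at
    -- both angles.
    have hmax : IsLocalMax (fun φ => x φ * cos ψ + y φ * sin ψ) θ := by
      refine Filter.Eventually.of_forall fun φ => ?_
      change x φ * cos ψ + y φ * sin ψ ≤ x θ * cos ψ + y θ * sin ψ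
      rw [e1, e2, hxy]
      exact hG φ ψ
    have hd := hmax.hasDerivAt_eq_zero (((hdx θ).mul_const _).add ((hdy θ).mul_const _))
    have hsin : sin (θ - ψ) = 0 := by
      have : radiusFn g θ * sin (θ - ψ) = 0 := by
        rw [sin_sub]; linear_combination -hd
      exact (mul_eq_zero.1 this).resolve_left (hr θ).ne'
    rcases sin_sub_eq_zero_cases hθ hψ hsin with h | ⟨hc, hs'⟩
    · rw [h]
    · exfalso
      have a1 := hxy θ
      rw [hc, hs', e1, e2] at a1
      have := hxy ψ
      linarith [hpos θ, hpos ψ]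
  have himg : F '' S = B \ {0} := by
    apply Set.Subset.antisymm
    · rintro _ ⟨⟨s, θ⟩, ⟨hs, hθ⟩, rfl⟩
      simp only at hs hθ
      refine ⟨fun ψ => ?_, ?_⟩
      · have h1 := mul_le_mul_of_nonneg_left (hG θ ψ) hs.1.le
        have h2 := mul_le_mul_of_nonneg_right hs.2 (hpos ψ).le
        simp only [hF, hx, hy]
        linarith
      · intro h
        simp only [hF, Set.mem_singleton_iff, Prod.mk_eq_zero] at h
        have h1 := hxy θ
        have h2 : s * g θ = 0 := by
          rw [← h1]; linear_combination cos θ * h.1 + sin θ * h.2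
        exact (mul_pos hs.1 (hpos θ)).ne' h2
    · rintro ⟨a, b⟩ ⟨hab, hne⟩
      have hcont : ContinuousOn (fun θ => (a * cos θ + b * sin θ) / g θ) (Set.Icc 0 (2 * π)) :=
        (Continuous.div (by fun_prop) hg.continuous fun θ => (hpos θ).ne').continuousOn
      obtain ⟨θ₁, hθ₁, hmax₁⟩ := isCompact_Icc.exists_isMaxOn
        (Set.nonempty_Icc.2 (by positivity)) hcont
      obtain ⟨θ₀, hθ₀, hθeq, hmax⟩ : ∃ θ₀ ∈ Set.Ico 0 (2 * π),
          (a * cos θ₀ + b * sin θ₀) / g θ₀ = (a * cos θ₁ + b * sin θ₁) / g θ₁ ∧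
          ∀ θ, (a * cos θ + b * sin θ) / g θ ≤ (a * cos θ₀ + b * sin θ₀) / g θ₀ := by
        have hq : Function.Periodic (fun θ => (a * cos θ + b * sin θ) / g θ) (2 * π) := fun θ => by
          simp only [cos_add_two_pi, sin_add_two_pi, hper θ]
        obtain ⟨θ₀, hθ₀, e⟩ := hq.exists_mem_Ico₀ two_pi_pos θ₁
        refine ⟨θ₀, hθ₀, e.symm, fun θ => ?_⟩
        obtain ⟨ψ, hψ, e'⟩ := hq.exists_mem_Ico₀ two_pi_pos θ
        calc _ = _ := e'
          _ ≤ _ := hmax₁ (Set.Ico_subset_Icc_self hψ)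
          _ = _ := e
      -- `m` is the gauge of `(a, b)`. The contact equation at `θ₀` and its derivative in `θ` are
      -- two linear equations whose solution is `(a, b) = m γ(θ₀)`.
      set m := (a * cos θ₀ + b * sin θ₀) / g θ₀ with hm
      have hmg : ∀ θ, a * cos θ + b * sin θ ≤ m * g θ := fun θ =>
        (div_le_iff₀ (hpos θ)).1 (hmax θ)
      have hm0 : m * g θ₀ = a * cos θ₀ + b * sin θ₀ := div_mul_cancel₀ _ (hpos θ₀).ne'
      have hm1 : m ≤ 1 := (div_le_one (hpos θ₀)).2 (hab θ₀)
      have hmpos : 0 < m := by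
        obtain ⟨θ, h1, h2⟩ := exists_polar a b
        have h3 := hmg θ
        have h4 := sin_sq_add_cos_sq θ
        set N := √(a ^ 2 + b ^ 2)
        have h5 : N ≤ m * g θ := by
          calc N = a * cos θ + b * sin θ := by
                linear_combination -cos θ * h1 - sin θ * h2 - N * h4
            _ ≤ _ := h3
        have h6 : 0 < N := by
          refine lt_of_le_of_ne (sqrt_nonneg _) fun h => hne ?_
          rw [← h] at h1 h2
          simp [h1, h2]
        exact pos_of_mul_pos_left (h6.trans_le h5) (hpos θ).le
      have hlm : IsLocalMax (fun θ => a * cos θ + b * sin θ - m * g θ) θ₀ := by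
        refine Filter.Eventually.of_forall fun φ => ?_
        change a * cos φ + b * sin φ - m * g φ ≤ a * cos θ₀ + b * sin θ₀ - m * g θ₀
        rw [hm0]
        linarith [hmg φ]
      have hd := hlm.hasDerivAt_eq_zero ((((hasDerivAt_cos θ₀).const_mul a).add
        ((hasDerivAt_sin θ₀).const_mul b)).sub ((hg.hasDerivAt_deriv θ₀).const_mul m))
      have h4 := sin_sq_add_cos_sq θ₀
      refine ⟨(m, θ₀), ⟨⟨hmpos, hm1⟩, hθ₀⟩, ?_⟩
      simp only [hF, hx, hy, Prod.mk.injEq]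
      constructor
      · linear_combination cos θ₀ * hm0 + sin θ₀ * hd + a * h4
      · linear_combination sin θ₀ * hm0 - cos θ₀ * hd + b * h4
  have hdet : ∀ q ∈ S, |(coneFDeriv (x q.2) (y q.2) (-(radiusFn g q.2 * sin q.2))
      (radiusFn g q.2 * cos q.2) q.1).det| = q.1 * (g q.2 * radiusFn g q.2) := by
    rintro ⟨s, θ⟩ ⟨hs, hθ⟩
    have e : (coneFDeriv (x θ) (y θ) (-(radiusFn g θ * sin θ))
        (radiusFn g θ * cos θ) s).det = s * (g θ * radiusFn g θ) := by
      rw [det_coneFDeriv, ← hxy θ]; ring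
    simp only [e]
    exact abs_of_pos (mul_pos hs.1 (mul_pos (hpos θ) (hr θ)))
  have hvol : volume.real B = volume.real (B \ {0}) := by
    rw [measureReal_def, measureReal_def, measure_sdiff_null (measure_singleton 0)]
  have hcv := integral_image_eq_integral_abs_det_fderiv_smul volume hSm
    (fun q _ => (hasFDerivAt_cone hdx hdy q).hasFDerivWithinAt) hinj (fun _ => (1 : ℝ))
  rw [himg] at hcv
  simp only [smul_eq_mul, mul_one, setIntegral_const] at hcv
  rw [hvol, hcv, setIntegral_congr_fun hSm hdet, hS, Measure.volume_eq_prod,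
    setIntegral_prod_mul (fun s : ℝ => s) (fun θ => g θ * radiusFn g θ)]
  rw [← intervalIntegral.integral_of_le zero_le_one, integral_id, integral_Ico_eq_integral_Ioc,
    ← intervalIntegral.integral_of_le (by positivity)]
  norm_num

theorem integral_deriv_eq_zero_of_periodic {F f : ℝ → ℝ} (hF : ∀ θ, HasDerivAt F (f θ) θ)
    (hf : Continuous f) (hper : Function.Periodic F (2 * π)) :
    ∫ θ in (0 : ℝ)..(2 * π), f θ = 0 := by
  rw [intervalIntegral.integral_eq_sub_of_hasDerivAt (fun θ _ => hF θ)
    (hf.intervalIntegrable _ _)]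
  have := hper 0
  rw [zero_add] at this
  rw [this, sub_self]

/-- This is the closing condition of the curve, `∮ dγ = 0`. It makes the area formula independent of
the choice of origin. -/
theorem integral_radiusFn_mul_trig {p : ℝ → ℝ} (hp : ContDiff ℝ ∞ p)
    (hper : Function.Periodic p (2 * π)) (x y : ℝ) :
    ∫ θ in (0 : ℝ)..(2 * π), (x * cos θ + y * sin θ) * radiusFn p θ = 0 := by
  have hR := hp.radiusFn.continuous
  refine integral_deriv_eq_zero_of_periodic (F := fun θ =>
    x * (deriv p θ * cos θ + p θ * sin θ) + y * (deriv p θ * sin θ - p θ * cos θ))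
    (fun θ => ?_) (by fun_prop) (fun θ => ?_)
  · have d0 := hp.hasDerivAt_deriv θ
    have d1 := hp.deriv_infty.hasDerivAt_deriv θ
    refine ((((d1.mul (hasDerivAt_cos θ)).add (d0.mul (hasDerivAt_sin θ))).const_mul x).add
      (((d1.mul (hasDerivAt_sin θ)).sub (d0.mul (hasDerivAt_cos θ))).const_mul y)).congr_deriv ?_
    simp only [radiusFn]; ring
  · simp only [cos_add_two_pi, sin_add_two_pi, hper θ, hper.deriv_periodic θ]

theorem integral_radiusFn {p : ℝ → ℝ} (hp : ContDiff ℝ ∞ p)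
    (hper : Function.Periodic p (2 * π)) :
    ∫ θ in (0 : ℝ)..(2 * π), radiusFn p θ = ∫ θ in (0 : ℝ)..(2 * π), p θ := by
  have h := integral_deriv_eq_zero_of_periodic (fun θ => hp.deriv_infty.hasDerivAt_deriv θ)
    hp.deriv_infty.deriv_infty.continuous hper.deriv_periodic
  unfold radiusFn
  rw [intervalIntegral.integral_add (hp.continuous.intervalIntegrable _ _)
    (hp.deriv_infty.deriv_infty.continuous.intervalIntegrable _ _), h, add_zero]

theorem radiusFn_sub_trig {p : ℝ → ℝ} (hp : ContDiff ℝ ∞ p) (x y s : ℝ) :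
    (deriv fun θ => p θ - (x * cos θ + y * sin θ) - s) =
        (fun θ => deriv p θ - (-(x * sin θ) + y * cos θ)) ∧
      radiusFn (fun θ => p θ - (x * cos θ + y * sin θ) - s) = fun θ => radiusFn p θ - s := by
  have h1 : (deriv fun θ => p θ - (x * cos θ + y * sin θ) - s) =
      fun θ => deriv p θ - (-(x * sin θ) + y * cos θ) := by
    funext θ
    refine (((hp.hasDerivAt_deriv θ).sub (((hasDerivAt_cos θ).const_mul x).add
      ((hasDerivAt_sin θ).const_mul y))).sub_const s).deriv.trans ?_
    ring
  refine ⟨h1, funext fun θ => ?_⟩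
  have h2 : deriv (fun θ => deriv p θ - (-(x * sin θ) + y * cos θ)) θ =
      deriv (deriv p) θ + (x * cos θ + y * sin θ) := by
    refine ((hp.deriv_infty.hasDerivAt_deriv θ).sub (((hasDerivAt_sin θ).const_mul x).neg.add
      ((hasDerivAt_cos θ).const_mul y))).deriv.trans ?_
    ring
  rw [radiusFn, h1, h2, radiusFn]
  ring

/-- The coordinates relative to the point `(x, y)` preserve the area. -/
theorem measurePreserving_planeCoord (x y : ℝ) :
    MeasurePreserving (fun z : Plane => ((z 0 - x, z 1 - y) : ℝ × ℝ)) volume volume := by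
  have h1 := PiLp.volume_preserving_ofLp (Fin 2)
  have h2 := volume_preserving_finTwoArrow ℝ
  have h3 := measurePreserving_sub_right (volume : Measure (ℝ × ℝ)) (x, y)
  exact h3.comp (h2.comp h1)

/-- The area of a smooth strictly convex domain is `½ ∫ p (p + p'')`. -/
theorem IsSmoothStrictlyConvexDomain.area_eq {K : Set Plane}
    (hK : IsSmoothStrictlyConvexDomain K) :
    area K = (1 / 2) * ∫ θ in (0 : ℝ)..(2 * π), supportFn K θ * radiusFn (supportFn K) θ := by
  obtain ⟨hp, hr, hmem⟩ := hK.supportFn_regular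
  have hper := supportFn_periodic K
  set p := supportFn K with hpdef
  obtain ⟨x₀, hx₀⟩ := hK.nonempty_interior
  obtain ⟨ε, hε, hball⟩ := Metric.nhds_basis_closedBall.mem_iff.1 (mem_interior_iff_mem_nhds.1 hx₀)
  set x := x₀ 0 with hx
  set y := x₀ 1 with hy
  -- Moving the origin to an interior point makes the support function positive, as the cone
  -- argument needs.
  set g : ℝ → ℝ := fun θ => p θ - (x * cos θ + y * sin θ) - 0 with hg
  have hgs : ContDiff ℝ ∞ g :=
    (hp.sub ((contDiff_const.mul contDiff_cos).add (contDiff_const.mul contDiff_sin))).sub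
      contDiff_const
  obtain ⟨hg', hgr⟩ := radiusFn_sub_trig hp x y 0
  have hgper : Function.Periodic g (2 * π) := fun θ => by
    simp only [hg, cos_add_two_pi, sin_add_two_pi, hper θ]
  have hgpos : ∀ θ, 0 < g θ := by
    intro θ
    have hmem : x₀ + ε • unitVec θ ∈ K := by
      apply hball
      rw [mem_closedBall_iff_norm, add_sub_cancel_left, norm_smul, unitVec, norm_plane]
      simp [abs_of_pos hε]
    have h1 := inner_le_supportFn hK.isCompact hmem θ
    have h2 := sin_sq_add_cos_sq θ
    simp only [PiLp.add_apply, PiLp.smul_apply, unitVec, Matrix.cons_val_zero,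
      Matrix.cons_val_one, Matrix.cons_val_fin_one, smul_eq_mul] at h1
    have h3 : (x + ε * cos θ) * cos θ + (y + ε * sin θ) * sin θ =
      x * cos θ + y * sin θ + ε := by linear_combination ε * h2
    simp only [hg]
    linarith
  have hmain := volume_real_of_support hgs hgper hgpos
    (fun θ => by rw [hgr]; exact (hr θ).trans_eq (sub_zero _).symm) (fun θ ψ => by
      have h1 := inner_le_supportFn hK.isCompact (hmem θ) ψ
      have h2 := sin_sq_add_cos_sq θ
      simp only [boundaryCurve, PiLp.toLp_apply, Matrix.cons_val_zero, Matrix.cons_val_one,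
        Matrix.cons_val_fin_one] at h1
      rw [hg']
      simp only [hg]
      have h3 : (p θ * cos θ - deriv p θ * sin θ) * cos ψ +
        (p θ * sin θ + deriv p θ * cos θ) * sin ψ ≤ p ψ := h1
      linear_combination h3 - (x * cos ψ + y * sin ψ) * h2)
  have hpre : K = (fun z : Plane => ((z 0 - x, z 1 - y) : ℝ × ℝ)) ⁻¹'
      {z : ℝ × ℝ | ∀ θ, z.1 * cos θ + z.2 * sin θ ≤ g θ} := by
    ext z
    rw [mem_iff_forall_le_supportFn hK.isCompact hK.strictConvex.convex
      (hK.nonempty_interior.mono interior_subset)]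
    refine forall_congr' fun θ => ?_
    simp only [hg]
    constructor <;> intro h <;> linarith
  have hclosed : IsClosed {z : ℝ × ℝ | ∀ θ, z.1 * cos θ + z.2 * sin θ ≤ g θ} := by
    simp only [Set.ofPred_forall]
    exact isClosed_iInter fun θ => isClosed_le (by fun_prop) (by fun_prop)
  have harea : area K =
      volume.real {z : ℝ × ℝ | ∀ θ, z.1 * cos θ + z.2 * sin θ ≤ g θ} := by
    rw [area, measureReal_def, measureReal_def]
    conv_lhs => rw [hpre]
    rw [(measurePreserving_planeCoord x y).measure_preimage hclosed.nullMeasurableSet]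
  rw [harea, hmain, hgr]
  congr 1
  have h0 := integral_radiusFn_mul_trig hp hper x y
  have hR := hp.radiusFn.continuous
  have hpc := hp.continuous
  have e : (fun θ => g θ * (radiusFn p θ - 0)) =
      fun θ => p θ * radiusFn p θ - (x * cos θ + y * sin θ) * radiusFn p θ := by
    funext θ; simp only [hg]; ring
  rw [e, intervalIntegral.integral_sub ((by fun_prop : Continuous _).intervalIntegrable _ _)
    ((by fun_prop : Continuous _).intervalIntegrable _ _), h0, sub_zero]

/-! ### Wirtinger's inequality, extremal disks and Bonnesen's inequality. -/

/-- Wirtinger's inequality with Dirichlet conditions, on an interval of length at most `π`. -/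
theorem integral_sq_le_integral_deriv_sq {q : ℝ → ℝ} (hq : ContDiff ℝ ∞ q) {a b : ℝ}
    (hab : a ≤ b) (hlen : b - a ≤ π) (ha : q a = 0) (hb : q b = 0) :
    ∫ θ in a..b, q θ ^ 2 ≤ ∫ θ in a..b, deriv q θ ^ 2 := by
  have hpi := pi_pos
  have hqc := hq.continuous
  have hqc' := hq.deriv_infty.continuous
  -- For `k < 1` the function `tan (k (θ - midpoint))` has no pole on the closed interval, even when
  -- its length is `π`. Completing the square with it leaves the derivative of `k q² tan`, whose
  -- integral vanishes; then `k → 1`.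
  have key : ∀ k : ℝ, 0 ≤ k → k < 1 →
      k ^ 2 * ∫ θ in a..b, q θ ^ 2 ≤ ∫ θ in a..b, deriv q θ ^ 2 := by
    intro k hk0 hk1
    set w : ℝ → ℝ := fun θ => k * (θ - (a + b) / 2) with hw
    have hwI : ∀ θ ∈ Set.Icc a b, w θ ∈ Set.Ioo (-(π / 2)) (π / 2) := by
      rintro θ ⟨h1, h2⟩
      have h3 : |θ - (a + b) / 2| ≤ π / 2 := by rw [abs_le]; constructor <;> linarith
      have h4 : |w θ| < π / 2 := by
        rw [hw, abs_mul, abs_of_nonneg hk0]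
        nlinarith [abs_nonneg (θ - (a + b) / 2)]
      exact abs_lt.1 h4
    have hcos : ∀ θ ∈ Set.Icc a b, cos (w θ) ≠ 0 := fun θ hθ =>
      (cos_pos_of_mem_Ioo (hwI θ hθ)).ne'
    have hdw : ∀ θ, HasDerivAt w k θ := fun θ => by
      simpa using ((hasDerivAt_id θ).sub_const ((a + b) / 2)).const_mul k
    have hdt : ∀ θ ∈ Set.Icc a b, HasDerivAt (fun θ => tan (w θ)) ((1 + tan (w θ) ^ 2) * k) θ := by
      intro θ hθ
      refine ((hasDerivAt_tan (hcos θ hθ)).comp θ (hdw θ)).congr_deriv ?_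
      rw [← inv_one_add_tan_sq (hcos θ hθ), one_div, inv_inv]
    have htc : ContinuousOn (fun θ => tan (w θ)) (Set.Icc a b) := fun θ hθ =>
      (hdt θ hθ).continuousAt.continuousWithinAt
    have hE : ∫ θ in a..b, (2 * q θ * deriv q θ * (k * tan (w θ)) +
        q θ ^ 2 * (k * ((1 + tan (w θ) ^ 2) * k))) = 0 := by
      rw [intervalIntegral.integral_eq_sub_of_hasDerivAt
        (f := fun θ => q θ ^ 2 * (k * tan (w θ)))]
      · simp [ha, hb]
      · intro θ hθ
        rw [Set.uIcc_of_le hab] at hθ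
        refine (((hq.hasDerivAt_deriv θ).pow 2).mul ((hdt θ hθ).const_mul k)).congr_deriv ?_
        simp
      · refine ContinuousOn.intervalIntegrable ?_
        rw [Set.uIcc_of_le hab]
        fun_prop
    have hpos : 0 ≤ ∫ θ in a..b, (deriv q θ + k * q θ * tan (w θ)) ^ 2 :=
      intervalIntegral.integral_nonneg hab fun θ _ => sq_nonneg _
    have hsplit : ∫ θ in a..b, (deriv q θ + k * q θ * tan (w θ)) ^ 2 =
        (∫ θ in a..b, deriv q θ ^ 2) - k ^ 2 * (∫ θ in a..b, q θ ^ 2) +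
          ∫ θ in a..b, (2 * q θ * deriv q θ * (k * tan (w θ)) +
        q θ ^ 2 * (k * ((1 + tan (w θ) ^ 2) * k))) := by
      rw [← intervalIntegral.integral_const_mul, ← intervalIntegral.integral_sub,
        ← intervalIntegral.integral_add]
      · congr 1; funext θ; ring
      all_goals
        refine ContinuousOn.intervalIntegrable ?_
        try rw [Set.uIcc_of_le hab]
        fun_prop
    rw [hE] at hsplit
    linarith
  have hlim : Filter.Tendsto (fun k : ℝ => k ^ 2 * ∫ θ in a..b, q θ ^ 2) (nhdsWithin 1 (Set.Iio 1))
      (nhds (1 ^ 2 * ∫ θ in a..b, q θ ^ 2)) :=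
    (Continuous.tendsto (by fun_prop) 1).mono_left nhdsWithin_le_nhds
  rw [one_pow, one_mul] at hlim
  refine le_of_tendsto hlim ?_
  filter_upwards [Ioo_mem_nhdsLT (zero_lt_one' ℝ)] with k hk
  exact key k hk.1.le hk.2

/-- A periodic function with a zero on each closed half-circle satisfies the
Wirtinger inequality. -/
theorem integral_sq_le_of_zero_on_half_circles {q : ℝ → ℝ} (hq : ContDiff ℝ ∞ q)
    (hper : Function.Periodic q (2 * π)) (hz : ∀ φ, ∃ θ ∈ Set.Icc φ (φ + π), q θ = 0) :
    ∫ θ in (0 : ℝ)..(2 * π), q θ ^ 2 ≤ ∫ θ in (0 : ℝ)..(2 * π), deriv q θ ^ 2 := by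
  have hpi := pi_pos
  obtain ⟨t₁, -, h1⟩ := hz 0
  have hZ : IsClosed {θ | q θ = 0} := isClosed_eq hq.continuous continuous_const
  have h1' : q (t₁ + 2 * π) = 0 := by rw [hper, h1]
  obtain ⟨t₂, ⟨⟨h2a, h2b⟩, h2⟩, hmax⟩ := (isCompact_Icc.inter_right hZ).exists_isGreatest
    (⟨t₁, ⟨le_rfl, by linarith⟩, h1⟩ : (Set.Icc t₁ (t₁ + π) ∩ {θ | q θ = 0}).Nonempty)
  obtain ⟨t₃, ⟨⟨h3a, h3b⟩, h3⟩, hmin⟩ := (isCompact_Icc.inter_right hZ).exists_isLeast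
    (⟨t₁ + 2 * π, ⟨by linarith, le_rfl⟩, h1'⟩ :
      (Set.Icc (t₁ + π) (t₁ + 2 * π) ∩ {θ | q θ = 0}).Nonempty)
  -- A longer gap would contain, around its midpoint, a closed half-circle without zeros of `q`. The
  -- zeros `t₁ ≤ t₂ ≤ t₃ ≤ t₁ + 2π` thus cut a period into arcs of length at most `π`.
  have hgap : t₃ - t₂ ≤ π := by
    by_contra! h
    obtain ⟨s, ⟨hs1, hs2⟩, hs⟩ := hz ((t₂ + t₃ - π) / 2)
    rcases le_total s (t₁ + π) with hc | hc
    · have := hmax ⟨⟨by linarith, hc⟩, hs⟩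
      linarith
    · have := hmin ⟨⟨hc, by linarith⟩, hs⟩
      linarith
  have i1 := integral_sq_le_integral_deriv_sq hq h2a (by linarith) h1 h2
  have i2 := integral_sq_le_integral_deriv_sq hq (by linarith) hgap h2 h3
  have i3 := integral_sq_le_integral_deriv_sq hq h3b (by linarith) h3 h1'
  have hc1 : Continuous fun θ => q θ ^ 2 := hq.continuous.pow 2
  have hc2 : Continuous fun θ => deriv q θ ^ 2 := hq.deriv_infty.continuous.pow 2
  have hp1 : Function.Periodic (fun θ => q θ ^ 2) (2 * π) := fun θ => by simp only [hper θ]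
  have hp2 : Function.Periodic (fun θ => deriv q θ ^ 2) (2 * π) := fun θ => by
    simp only [hper.deriv_periodic θ]
  have hs : ∀ {f : ℝ → ℝ}, Continuous f → Function.Periodic f (2 * π) →
      ∫ θ in (0 : ℝ)..(2 * π), f θ =
        (∫ θ in t₁..t₂, f θ) + (∫ θ in t₂..t₃, f θ) + ∫ θ in t₃..(t₁ + 2 * π), f θ := by
    intro f hf hfp
    have := hfp.intervalIntegral_add_eq 0 t₁
    rw [zero_add] at this
    rw [this, intervalIntegral.integral_add_adjacent_intervals (hf.intervalIntegrable _ _)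
      (hf.intervalIntegrable _ _), intervalIntegral.integral_add_adjacent_intervals
      (hf.intervalIntegrable _ _) (hf.intervalIntegrable _ _)]
  rw [hs hc1 hp1, hs hc2 hp2]
  linarith

/-- Best one-sided approximation of a periodic function from above by `s + x cos θ + y sin θ`
with `s` minimal; the contact set meets every closed half-circle. -/
theorem exists_optimal_disk {f : ℝ → ℝ} (hf : Continuous f)
    (hper : Function.Periodic f (2 * π)) :
    ∃ x y s : ℝ, (∀ θ, f θ ≤ x * cos θ + y * sin θ + s) ∧
      (∀ x' y' s' : ℝ, (∀ θ, f θ ≤ x' * cos θ + y' * sin θ + s') → s ≤ s') ∧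
      ∀ φ, ∃ θ ∈ Set.Icc φ (φ + π), f θ = x * cos θ + y * sin θ + s := by
  have hpi := pi_pos
  obtain ⟨M, hM⟩ : ∃ M, ∀ θ, |f θ| ≤ M := by
    obtain ⟨M, hM⟩ := isCompact_Icc.exists_bound_of_continuousOn (s := Set.Icc 0 (2 * π))
      hf.continuousOn
    refine ⟨M, fun θ => ?_⟩
    obtain ⟨ψ, hψ, e⟩ := hper.exists_mem_Ico₀ two_pi_pos θ
    rw [e]
    exact hM ψ (Set.Ico_subset_Icc_self hψ)
  have hM0 : 0 ≤ M := (abs_nonneg _).trans (hM 0)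
  set C : Set (ℝ × ℝ × ℝ) := {z | ∀ θ, f θ ≤ z.1 * cos θ + z.2.1 * sin θ + z.2.2} with hC
  have hCc : IsClosed C := by
    simp only [hC, Set.ofPred_forall]
    exact isClosed_iInter fun θ => isClosed_le (by fun_prop) (by fun_prop)
  -- The constraints at the angles `0`, `π`, `±π/2` alone bound the coefficients by `s`, so the
  -- minimization takes place in a compact box.
  have hlow : ∀ z ∈ C, |z.1| ≤ z.2.2 + M ∧ |z.2.1| ≤ z.2.2 + M := by
    rintro ⟨x, y, s⟩ h
    have a0 := h 0
    have a1 := h π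
    have a2 := h (π / 2)
    have a3 := h (-(π / 2))
    simp at a0 a1 a2 a3
    have b0 := abs_le.1 (hM 0)
    have b1 := abs_le.1 (hM π)
    have b2 := abs_le.1 (hM (π / 2))
    have b3 := abs_le.1 (hM (-(π / 2)))
    simp only [abs_le]
    refine ⟨⟨?_, ?_⟩, ?_, ?_⟩ <;> linarith
  set B : Set (ℝ × ℝ × ℝ) := Set.Icc (-(2 * M), -(2 * M), -M) (2 * M, 2 * M, M) with hB
  have hcomp : IsCompact (B ∩ C) := isCompact_Icc.inter_right hCc
  have h0 : ((0, 0, M) : ℝ × ℝ × ℝ) ∈ B ∩ C := by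
    refine ⟨⟨⟨?_, ?_, ?_⟩, ?_, ?_, ?_⟩, fun θ => ?_⟩
    · simp; linarith
    · simp; linarith
    · simp; linarith
    · simp; linarith
    · simp; linarith
    · simp
    · simpa using (abs_le.1 (hM θ)).2
  obtain ⟨⟨x, y, s⟩, ⟨hzB, hzC⟩, hmin⟩ := hcomp.exists_isMinOn ⟨_, h0⟩
    (continuous_snd.snd.continuousOn)
  have hopt : ∀ x' y' s' : ℝ, (∀ θ, f θ ≤ x' * cos θ + y' * sin θ + s') → s ≤ s' := by
    intro x' y' s' h
    rcases le_total M s' with hs | hs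
    · exact (hmin h0).trans hs
    · obtain ⟨c1, c2⟩ := hlow (x', y', s') h
      simp only [abs_le] at c1 c2
      refine hmin (⟨⟨⟨?_, ?_, ?_⟩, ?_, ?_, ?_⟩, h⟩ : (x', y', s') ∈ B ∩ C) <;>
      · simp only
        linarith
  refine ⟨x, y, s, hzC, hopt, ?_⟩
  by_contra! hcon
  obtain ⟨φ, hφ⟩ := hcon
  set d : ℝ → ℝ := fun θ => x * cos θ + y * sin θ + s - f θ with hd
  have hdc : Continuous d := by fun_prop
  have hd0 : ∀ θ, 0 ≤ d θ := fun θ => sub_nonneg.2 (hzC θ)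
  have hdper : Function.Periodic d (2 * π) := fun θ => by
    simp only [hd, cos_add_two_pi, sin_add_two_pi, hper θ]
  obtain ⟨ψ, hψ, hmψ⟩ := isCompact_Icc.exists_isMinOn (Set.nonempty_Icc.2 (by linarith))
    (hdc.continuousOn (s := Set.Icc φ (φ + π)))
  have hdψ : 0 < d ψ := lt_of_le_of_ne (hd0 ψ) fun h => hφ ψ hψ (by
    simp only [hd] at h; linarith)
  -- With no contact on `[φ, φ + π]`, shifting the center away from the middle of that arc by `ε`
  -- leaves positive slack everywhere: the slack was at least `2ε` on the arc, and the cosine is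
  -- negative off it. Then `s` can be decreased.
  set ε := d ψ / 2 with hε
  set e : ℝ → ℝ := fun θ => d θ - ε * cos (θ - (φ + π / 2)) with he
  have hec : Continuous e := by fun_prop
  have heper : Function.Periodic e (2 * π) := fun θ => by
    simp only [he, hdper θ, show θ + 2 * π - (φ + π / 2) = θ - (φ + π / 2) + 2 * π by ring,
      cos_add_two_pi]
  have hepos : ∀ θ, 0 < e θ := by
    intro θ
    obtain ⟨t, ht, e'⟩ := heper.exists_mem_Ico two_pi_pos θ φ
    rw [e']
    rcases le_or_gt t (φ + π) with h | h
    · have h1 : d ψ ≤ d t := hmψ ⟨ht.1, h⟩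
      have h2 := cos_le_one (t - (φ + π / 2))
      simp only [he]
      nlinarith
    · have h1 := hd0 t
      have h2 : cos (t - (φ + π / 2)) < 0 :=
        cos_neg_of_pi_div_two_lt_of_lt (by linarith) (by linarith [ht.2])
      simp only [he]
      nlinarith
  obtain ⟨t, ht, hmt⟩ := isCompact_Icc.exists_isMinOn (Set.nonempty_Icc.2 two_pi_pos.le)
    (hec.continuousOn (s := Set.Icc 0 (2 * π)))
  have hemin : ∀ θ, e t ≤ e θ := fun θ => by
    obtain ⟨t', ht', e'⟩ := heper.exists_mem_Ico₀ two_pi_pos θ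
    rw [e']
    exact hmt (Set.Ico_subset_Icc_self ht')
  have := hopt (x - ε * cos (φ + π / 2)) (y - ε * sin (φ + π / 2)) (s - e t) fun θ => by
    have h1 := hemin θ
    have h2 : e θ = x * cos θ + y * sin θ + s - f θ -
      ε * (cos θ * cos (φ + π / 2) + sin θ * sin (φ + π / 2)) := by
      simp only [he, hd, cos_sub]
    linarith
  linarith [hepos t]

theorem integral_mul_radiusFn {p : ℝ → ℝ} (hp : ContDiff ℝ ∞ p)
    (hper : Function.Periodic p (2 * π)) :
    ∫ θ in (0 : ℝ)..(2 * π), p θ * radiusFn p θ =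
      (∫ θ in (0 : ℝ)..(2 * π), p θ ^ 2) - ∫ θ in (0 : ℝ)..(2 * π), deriv p θ ^ 2 := by
  have c0 := hp.continuous
  have c1 := hp.deriv_infty.continuous
  have c2 := hp.deriv_infty.deriv_infty.continuous
  have h := integral_deriv_eq_zero_of_periodic (F := fun θ => p θ * deriv p θ)
    (fun θ => (hp.hasDerivAt_deriv θ).mul (hp.deriv_infty.hasDerivAt_deriv θ)) (by fun_prop)
    (fun θ => by simp only [hper θ, hper.deriv_periodic θ])
  have cr := hp.radiusFn.continuous
  have hi : ∀ {f : ℝ → ℝ}, Continuous f → IntervalIntegrable f volume 0 (2 * π) := fun hf =>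
    hf.intervalIntegrable _ _
  rw [← intervalIntegral.integral_sub (hi (by fun_prop)) (hi (by fun_prop)), ← sub_eq_zero,
    ← intervalIntegral.integral_sub (hi (by fun_prop)) (hi (by fun_prop)), ← h]
  congr 1; funext θ; simp only [radiusFn]; ring

/-- If `p - s - x cos θ - y sin θ` vanishes somewhere on each closed half-circle, then `s` lies
between the roots of the isoperimetric polynomial of `p`. -/
theorem isoperimetric_poly_nonpos {p : ℝ → ℝ} (hp : ContDiff ℝ ∞ p)
    (hper : Function.Periodic p (2 * π)) {x y s : ℝ}
    (hz : ∀ φ, ∃ θ ∈ Set.Icc φ (φ + π), p θ = x * cos θ + y * sin θ + s) :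
    (1 / 2) * (∫ θ in (0 : ℝ)..(2 * π), p θ * radiusFn p θ) -
      s * (∫ θ in (0 : ℝ)..(2 * π), p θ) + π * s ^ 2 ≤ 0 := by
  set q : ℝ → ℝ := fun θ => p θ - (x * cos θ + y * sin θ) - s with hq
  have hqs : ContDiff ℝ ∞ q :=
    (hp.sub ((contDiff_const.mul contDiff_cos).add (contDiff_const.mul contDiff_sin))).sub
      contDiff_const
  have hqper : Function.Periodic q (2 * π) := fun θ => by
    simp only [hq, cos_add_two_pi, sin_add_two_pi, hper θ]
  have h1 := integral_sq_le_of_zero_on_half_circles hqs hqper fun φ => by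
    obtain ⟨θ, hθ, e⟩ := hz φ
    exact ⟨θ, hθ, by simp only [hq, e]; ring⟩
  have h2 := integral_mul_radiusFn hqs hqper
  have c0 := hp.continuous
  have cr := hp.radiusFn.continuous
  -- Wirtinger's inequality says `∫ q (q + q'') ≤ 0`. Expanding in `s`, with the trigonometric terms
  -- integrating to zero, gives twice the isoperimetric polynomial.
  have e : (fun θ => q θ * radiusFn q θ) = fun θ => (p θ * radiusFn p θ - s * p θ) -
      ((x * cos θ + y * sin θ) * radiusFn p θ + s * radiusFn p θ) +
      (x * s * cos θ + y * s * sin θ + s ^ 2) := by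
    funext θ
    rw [(radiusFn_sub_trig hp x y s).2]
    simp only [hq]; ring
  have hi : ∀ {f : ℝ → ℝ}, Continuous f → IntervalIntegrable f volume 0 (2 * π) := fun hf =>
    hf.intervalIntegrable _ _
  rw [e, intervalIntegral.integral_add (hi (by fun_prop)) (hi (by fun_prop)),
    intervalIntegral.integral_sub (hi (by fun_prop)) (hi (by fun_prop)),
    intervalIntegral.integral_sub (hi (by fun_prop)) (hi (by fun_prop)),
    intervalIntegral.integral_add (hi (by fun_prop)) (hi (by fun_prop)),
    intervalIntegral.integral_add (hi (by fun_prop)) (hi (by fun_prop)),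
    intervalIntegral.integral_add (hi (by fun_prop)) (hi (by fun_prop)),
    integral_radiusFn_mul_trig hp hper] at h2
  simp only [intervalIntegral.integral_const_mul, integral_radiusFn hp hper, integral_cos,
    integral_sin, intervalIntegral.integral_const, smul_eq_mul, sin_two_pi, cos_two_pi, sin_zero,
    cos_zero] at h2
  linarith

section

variable {K : Set Plane}

theorem inner_sub_unitVec_le (z x : Plane) (θ : ℝ) :
    z 0 * cos θ + z 1 * sin θ ≤ x 0 * cos θ + x 1 * sin θ + dist z x := by
  have h := real_inner_le_norm (z - x) (unitVec θ)
  rw [inner_unitVec, unitVec, norm_plane, cos_sq_add_sin_sq, sqrt_one, mul_one,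
    ← dist_eq_norm] at h
  simp only [PiLp.sub_apply] at h
  linarith

theorem exists_dist_eq_inner (z x : Plane) :
    ∃ θ, z 0 * cos θ + z 1 * sin θ = x 0 * cos θ + x 1 * sin θ + dist z x := by
  obtain ⟨θ, h1, h2⟩ := exists_polar (z 0 - x 0) (z 1 - x 1)
  refine ⟨θ, ?_⟩
  have h3 := sin_sq_add_cos_sq θ
  have h4 : dist z x = √((z 0 - x 0) ^ 2 + (z 1 - x 1) ^ 2) := by
    rw [EuclideanSpace.dist_eq, Fin.sum_univ_two, Real.dist_eq, Real.dist_eq, sq_abs, sq_abs]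
  rw [← h4] at h1 h2
  linear_combination cos θ * h1 + sin θ * h2 + dist z x * h3

theorem subset_closedBall_iff (hK : IsCompact K) (hne : K.Nonempty) (x : Plane) (R : ℝ) :
    K ⊆ Metric.closedBall x R ↔ ∀ θ, supportFn K θ ≤ x 0 * cos θ + x 1 * sin θ + R := by
  constructor
  · intro h θ
    refine supportFn_le hne fun z hz => ?_
    have h1 := inner_sub_unitVec_le z x θ
    have h2 : dist z x ≤ R := h hz
    linarith
  · intro h z hz
    obtain ⟨θ, hθ⟩ := exists_dist_eq_inner z x
    have h1 := inner_le_supportFn hK hz θ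
    have h2 := h θ
    rw [Metric.mem_closedBall]
    linarith

theorem closedBall_subset_iff (hK : IsCompact K) (hc : Convex ℝ K) (hne : K.Nonempty)
    (x : Plane) {r : ℝ} (hr : 0 ≤ r) :
    Metric.closedBall x r ⊆ K ↔ ∀ θ, x 0 * cos θ + x 1 * sin θ + r ≤ supportFn K θ := by
  constructor
  · intro h θ
    have hmem : x + r • unitVec θ ∈ K := by
      apply h
      rw [mem_closedBall_iff_norm, add_sub_cancel_left, norm_smul, unitVec, norm_plane]
      simp [abs_of_nonneg hr]
    have h1 := inner_le_supportFn hK hmem θ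
    have h2 := sin_sq_add_cos_sq θ
    simp only [PiLp.add_apply, PiLp.smul_apply, unitVec, Matrix.cons_val_zero,
      Matrix.cons_val_one, Matrix.cons_val_fin_one, smul_eq_mul] at h1
    linear_combination h1 - r * h2
  · intro h z hz
    rw [mem_iff_forall_le_supportFn hK hc hne]
    intro θ
    have h1 := inner_sub_unitVec_le z x θ
    have h2 : dist z x ≤ r := hz
    have h3 := h θ
    linarith

theorem supportFn_closedBall (x : Plane) {r : ℝ} (hr : 0 ≤ r) (θ : ℝ) :
    supportFn (Metric.closedBall x r) θ = x 0 * cos θ + x 1 * sin θ + r := by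
  have hK : IsCompact (Metric.closedBall x r) := isCompact_closedBall x r
  have hne : (Metric.closedBall x r).Nonempty := Metric.nonempty_closedBall.2 hr
  exact le_antisymm ((subset_closedBall_iff hK hne x r).1 subset_rfl θ)
    ((closedBall_subset_iff hK (convex_closedBall x r) hne x hr).1 subset_rfl θ)

namespace IsSmoothStrictlyConvexDomain

theorem nonempty (hK : IsSmoothStrictlyConvexDomain K) : K.Nonempty :=
  hK.nonempty_interior.mono interior_subset

theorem contDiff_supportFn (hK : IsSmoothStrictlyConvexDomain K) : ContDiff ℝ ∞ (supportFn K) :=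
  hK.supportFn_regular.1

theorem radiusFn_pos (hK : IsSmoothStrictlyConvexDomain K) (θ : ℝ) :
    0 < radiusFn (supportFn K) θ :=
  hK.supportFn_regular.2.1 θ

theorem perimeter_eq (hK : IsSmoothStrictlyConvexDomain K) :
    perimeter K = ∫ θ in (0 : ℝ)..(2 * π), supportFn K θ := by
  rw [perimeter_eq_integral_radiusFn hK.contDiff_supportFn hK.radiusFn_pos,
    integral_radiusFn hK.contDiff_supportFn (supportFn_periodic K)]

theorem outerRadius_poly_nonpos (hK : IsSmoothStrictlyConvexDomain K) :
    area K - outerRadius K * perimeter K + π * outerRadius K ^ 2 ≤ 0 := by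
  have hp := hK.contDiff_supportFn
  have hper := supportFn_periodic K
  obtain ⟨x, y, s, hle, hopt, hz⟩ := exists_optimal_disk hp.continuous hper
  have hs : outerRadius K = s := by
    refine IsLeast.csInf_eq ⟨?_, ?_⟩
    · have hsub : K ⊆ Metric.closedBall !₂[x, y] s :=
        (subset_closedBall_iff hK.isCompact hK.nonempty _ _).2 hle
      obtain ⟨z, hz⟩ := hK.nonempty
      exact ⟨dist_nonneg.trans (hsub hz), _, hsub⟩
    · rintro R ⟨-, c, hc⟩
      exact hopt _ _ _ ((subset_closedBall_iff hK.isCompact hK.nonempty _ _).1 hc)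
  have := isoperimetric_poly_nonpos hp hper hz
  rwa [← hK.area_eq, ← hK.perimeter_eq, ← hs] at this

theorem innerRadius_poly_nonpos (hK : IsSmoothStrictlyConvexDomain K) :
    area K - innerRadius K * perimeter K + π * innerRadius K ^ 2 ≤ 0 := by
  have hp := hK.contDiff_supportFn
  have hper := supportFn_periodic K
  have hconv := hK.strictConvex.convex
  -- The largest inscribed disk for `p` is the least majorant for `-p`, with center and radius
  -- negated.
  obtain ⟨x, y, s, hle, hopt, hz⟩ := exists_optimal_disk (f := fun θ => -supportFn K θ)
    hp.continuous.neg (fun θ => by simp only [hper θ])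
  have hs0 : 0 ≤ -s := by
    obtain ⟨z, hz⟩ := hK.nonempty
    have := hopt (-z 0) (-z 1) 0 fun θ => by
      linarith [inner_le_supportFn hK.isCompact hz θ]
    linarith
  have hs : innerRadius K = -s := by
    refine IsGreatest.csSup_eq ⟨⟨hs0, !₂[-x, -y], ?_⟩, ?_⟩
    · rw [closedBall_subset_iff hK.isCompact hconv hK.nonempty _ hs0]
      intro θ
      have := hle θ
      change -x * cos θ + -y * sin θ + -s ≤ _
      linarith
    · rintro r ⟨hr, c, hc⟩
      rw [closedBall_subset_iff hK.isCompact hconv hK.nonempty _ hr] at hc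
      have := hopt (-c 0) (-c 1) (-r) fun θ => by linarith [hc θ]
      linarith
  have := isoperimetric_poly_nonpos hp hper (x := -x) (y := -y) (s := -s) fun φ => by
    obtain ⟨θ, hθ, e⟩ := hz φ
    exact ⟨θ, hθ, by linarith⟩
  rwa [← hK.area_eq, ← hK.perimeter_eq, ← hs] at this

/-- **Bonnesen's inequality**. -/
theorem bonnesen (hK : IsSmoothStrictlyConvexDomain K) :
    π ^ 2 * (outerRadius K - innerRadius K) ^ 2 ≤ perimeter K ^ 2 - 4 * π * area K := by
  have hpi := pi_pos
  have h1 := mul_nonneg_of_nonpos_of_nonpos hK.outerRadius_poly_nonpos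
    (by linarith : -(4 * π) ≤ 0)
  have h2 := mul_nonneg_of_nonpos_of_nonpos hK.innerRadius_poly_nonpos
    (by linarith : -(4 * π) ≤ 0)
  -- With `Δ = L² - 4πA`, both radii satisfy `(2πs - L)² ≤ Δ`; the parallelogram identity then gives
  -- `4π² (ρ_e - ρ_i)² ≤ 4Δ`.
  nlinarith [sq_nonneg (2 * π * outerRadius K - perimeter K +
    (2 * π * innerRadius K - perimeter K))]

end IsSmoothStrictlyConvexDomain

end

/-! ### Fourier series and moments. -/

/-- The `n`-th complex Fourier coefficient on `[0, 2π]`. -/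
noncomputable def angularCoeff (f : ℝ → ℝ) (n : ℤ) : ℂ :=
  (1 / (2 * π) : ℝ) • ∫ θ in (0 : ℝ)..(2 * π), Complex.exp (-(n * θ * Complex.I)) * f θ

theorem fourier_eq_exp {T : ℝ} (hT : T = 2 * π) (n : ℤ) (θ : ℝ) :
    (fourier n (θ : AddCircle T) : ℂ) = Complex.exp (n * θ * Complex.I) := by
  have hpi : (π : ℂ) ≠ 0 := by exact_mod_cast pi_pos.ne'
  rw [fourier_coe_apply, hT]
  congr 1
  push_cast
  field_simp

theorem fourierCoeffOn_eq_angularCoeff (f : ℝ → ℝ) (n : ℤ) :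
    fourierCoeffOn two_pi_pos (fun θ => (f θ : ℂ)) n = angularCoeff f n := by
  rw [fourierCoeffOn_eq_integral, angularCoeff, sub_zero]
  congr 1
  refine intervalIntegral.integral_congr fun θ _ => ?_
  simp only [smul_eq_mul]
  rw [fourier_eq_exp rfl]
  push_cast
  congr 2
  ring

theorem hasSum_sq_angularCoeff {f : ℝ → ℝ} (hf : Continuous f) :
    HasSum (fun n => ‖angularCoeff f n‖ ^ 2)
      ((1 / (2 * π)) * ∫ θ in (0 : ℝ)..(2 * π), f θ ^ 2) := by
  have hc : Continuous fun θ => (f θ : ℂ) := Complex.continuous_ofReal.comp hf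
  have hL2 : MemLp (fun θ => (f θ : ℂ)) 2 (volume.restrict (Set.Ioc 0 (2 * π))) := by
    obtain ⟨C, hC⟩ := isCompact_Icc.exists_bound_of_continuousOn (s := Set.Icc 0 (2 * π))
      hc.continuousOn
    refine MemLp.of_bound hc.aestronglyMeasurable C ?_
    filter_upwards [ae_restrict_mem measurableSet_Ioc] with θ hθ
    exact hC θ (Set.Ioc_subset_Icc_self hθ)
  have h := hasSum_sq_fourierCoeffOn two_pi_pos hL2
  simp only [fourierCoeffOn_eq_angularCoeff, Complex.norm_real, Real.norm_eq_abs, sq_abs, sub_zero,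
    smul_eq_mul] at h
  rwa [one_div]

theorem norm_sq_angularCoeff_deriv {f : ℝ → ℝ} (hf : ContDiff ℝ ∞ f)
    (hper : Function.Periodic f (2 * π)) (n : ℤ) :
    ‖angularCoeff (deriv f) n‖ ^ 2 = (n : ℝ) ^ 2 * ‖angularCoeff f n‖ ^ 2 := by
  rcases eq_or_ne n 0 with rfl | hn
  · have h := integral_deriv_eq_zero_of_periodic (fun θ => hf.hasDerivAt_deriv θ)
      hf.deriv_infty.continuous hper
    simp [angularCoeff, intervalIntegral.integral_ofReal, h]
  · have h := fourierCoeffOn_of_hasDerivAt two_pi_pos hn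
      (fun θ _ => (hf.hasDerivAt_deriv θ).ofReal_comp)
      ((Complex.continuous_ofReal.comp hf.deriv_infty.continuous).intervalIntegrable _ _)
    have h0 := hper 0
    rw [zero_add] at h0
    simp only [h0, sub_self, mul_zero, zero_sub] at h
    rw [fourierCoeffOn_eq_angularCoeff, fourierCoeffOn_eq_angularCoeff (deriv f)] at h
    have hn' : (n : ℂ) ≠ 0 := by exact_mod_cast hn
    have hpi : (π : ℂ) ≠ 0 := by exact_mod_cast pi_pos.ne'
    have h2 : angularCoeff (deriv f) n = Complex.I * n * angularCoeff f n := by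
      rw [h]
      push_cast
      field_simp
      ring
    rw [h2, norm_mul, norm_mul, Complex.norm_I, Complex.norm_intCast, mul_pow, one_mul, sq_abs]

/-- Pointwise convergence of the Fourier series of a periodic continuous function whose Fourier
coefficients are summable. -/
theorem hasSum_angularCoeff_mul_exp {f : ℝ → ℝ} (hf : Continuous f)
    (hper : Function.Periodic f (2 * π)) (hs : Summable (angularCoeff f)) (θ : ℝ) :
    HasSum (fun n : ℤ => angularCoeff f n * Complex.exp (n * θ * Complex.I)) (f θ) := by
  have : Fact (0 < 2 * π) := ⟨two_pi_pos⟩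
  have hper' : Function.Periodic (fun θ => (f θ : ℂ)) (2 * π) := fun θ => by simp only [hper θ]
  set F : C(AddCircle (2 * π), ℂ) := ⟨hper'.lift,
    continuous_coinduced_dom.mpr (Complex.continuous_ofReal.comp hf)⟩ with hF
  have hFc : ∀ θ : ℝ, F (θ : AddCircle (2 * π)) = f θ := fun θ => rfl
  have hco : ∀ n, fourierCoeff F n = angularCoeff f n := by
    intro n
    rw [fourierCoeff_eq_intervalIntegral _ _ 0, angularCoeff, zero_add]
    congr 1
    refine intervalIntegral.integral_congr fun θ _ => ?_
    simp only [smul_eq_mul, hFc]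
    rw [fourier_eq_exp rfl]
    push_cast
    congr 2
    ring
  have h := has_pointwise_sum_fourier_series_of_summable (f := F)
    (hs.congr fun n => (hco n).symm) (θ : AddCircle (2 * π))
  simpa only [hco, smul_eq_mul, fourier_eq_exp rfl, hFc] using h

theorem angularCoeff_eq_cos_sin {f : ℝ → ℝ} (hf : Continuous f) (n : ℤ) :
    angularCoeff f n = (1 / (2 * π) : ℝ) *
      ((∫ θ in (0 : ℝ)..(2 * π), f θ * cos (n * θ) : ℝ) -
        (∫ θ in (0 : ℝ)..(2 * π), f θ * sin (n * θ) : ℝ) * Complex.I) := by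
  have e : (fun θ : ℝ => Complex.exp (-(n * θ * Complex.I)) * f θ) = fun θ : ℝ =>
      ((f θ * cos (n * θ) : ℝ) : ℂ) - ((f θ * sin (n * θ) : ℝ) : ℂ) * Complex.I := by
    funext θ
    rw [← neg_mul, Complex.exp_mul_I, Complex.cos_neg, Complex.sin_neg]
    push_cast
    ring
  have c1 : Continuous fun θ : ℝ => ((f θ * cos (n * θ) : ℝ) : ℂ) := by fun_prop
  have c2 : Continuous fun θ : ℝ => ((f θ * sin (n * θ) : ℝ) : ℂ) * Complex.I := by fun_prop
  rw [angularCoeff, e, intervalIntegral.integral_sub (c1.intervalIntegrable _ _)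
    (c2.intervalIntegrable _ _), intervalIntegral.integral_mul_const,
    intervalIntegral.integral_ofReal, intervalIntegral.integral_ofReal, Complex.real_smul]

/-- The terms of order at most one of the Fourier series. -/
theorem angularCoeff_low_order {f : ℝ → ℝ} (hf : Continuous f) (θ : ℝ) :
    ∑ n ∈ ({-1, 0, 1} : Finset ℤ), angularCoeff f n * Complex.exp (n * θ * Complex.I) =
      (((1 / π * ∫ θ in (0 : ℝ)..(2 * π), f θ * cos θ) * cos θ +
        (1 / π * ∫ θ in (0 : ℝ)..(2 * π), f θ * sin θ) * sin θ +
        (∫ θ in (0 : ℝ)..(2 * π), f θ) / (2 * π) : ℝ) : ℂ) := by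
  have hpi : (π : ℂ) ≠ 0 := by exact_mod_cast pi_pos.ne'
  rw [Finset.sum_insert (by decide), Finset.sum_insert (by decide), Finset.sum_singleton,
    angularCoeff_eq_cos_sin hf, angularCoeff_eq_cos_sin hf, angularCoeff_eq_cos_sin hf,
    Complex.exp_mul_I, Complex.exp_mul_I, Complex.exp_mul_I]
  simp only [Int.cast_neg, Int.cast_one, Int.cast_zero, neg_mul, one_mul, zero_mul, cos_neg,
    sin_neg, cos_zero, sin_zero, mul_one, mul_zero, intervalIntegral.integral_zero, mul_neg,
    intervalIntegral.integral_neg, Complex.cos_neg, Complex.sin_neg, Complex.cos_zero,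
    Complex.sin_zero]
  push_cast
  field_simp
  ring_nf
  rw [Complex.I_sq]
  ring

/-- Since `1/(n² - 1) = ½ (1/(n - 1) - 1/(n + 1))`, the sum over `n ≥ 2` telescopes to `3/4`, and
the negative `n` double it. This is the source of the `3/2` in the stability constant. -/
theorem hasSum_inv_sq_sub_one :
    HasSum (fun n : ℤ => if n ^ 2 ≤ 1 then (0 : ℝ) else 1 / ((n : ℝ) ^ 2 - 1)) (3 / 2) := by
  set e : ℤ → ℝ := fun n => if n ^ 2 ≤ 1 then (0 : ℝ) else 1 / ((n : ℝ) ^ 2 - 1) with he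
  have hshift : HasSum (fun k : ℕ => 1 / (((k : ℝ) + 2) ^ 2 - 1)) (3 / 4) := by
    rw [hasSum_iff_tendsto_nat_of_nonneg]
    · have hsum : ∀ N : ℕ, ∑ k ∈ Finset.range N, 1 / (((k : ℝ) + 2) ^ 2 - 1) =
          3 / 4 - (1 / 2) * (1 / ((N : ℝ) + 1) + 1 / ((N : ℝ) + 1 + 1)) := by
        intro N
        induction N with
        | zero => norm_num
        | succ N ih =>
          rw [Finset.sum_range_succ, ih]
          have h1 : (N : ℝ) + 1 ≠ 0 := by positivity
          have h2 : (N : ℝ) + 1 + 1 ≠ 0 := by positivity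
          have h3 : (N : ℝ) + 1 + 1 + 1 ≠ 0 := by positivity
          have h4 : ((N : ℝ) + 2) ^ 2 - 1 = (N + 1) * (N + 1 + 1 + 1) := by ring
          rw [h4]
          push_cast
          field_simp
          ring
      simp only [hsum]
      have t1 := tendsto_one_div_add_atTop_nhds_zero_nat (𝕜 := ℝ)
      have t2 : Filter.Tendsto (fun N : ℕ => 1 / ((N : ℝ) + 1 + 1)) Filter.atTop (nhds 0) := by
        have := t1.comp (Filter.tendsto_add_atTop_nat 1)
        refine this.congr fun N => ?_
        simp
      have t3 := ((t1.add t2).const_mul (1 / 2)).const_sub (3 / 4)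
      rwa [add_zero, mul_zero, sub_zero] at t3
    · intro k
      have : (0 : ℝ) ≤ k := Nat.cast_nonneg k
      exact one_div_nonneg.2 (by nlinarith)
  have hnat : HasSum (fun n : ℕ => e n) (3 / 4) := by
    rw [← hasSum_nat_add_iff' 2]
    have h0 : ∑ i ∈ Finset.range 2, e (i : ℤ) = 0 := by
      simp [Finset.sum_range_succ, he]
    rw [h0, sub_zero]
    have hk : ∀ k : ℕ, e ((k + 2 : ℕ) : ℤ) = 1 / (((k : ℝ) + 2) ^ 2 - 1) := fun k => by
      have hk0 : (0 : ℤ) ≤ k := Int.natCast_nonneg k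
      simp only [he]
      rw [if_neg (by push_cast; nlinarith)]
      push_cast
      rfl
    simpa only [hk] using hshift
  have h := HasSum.of_nat_of_neg hnat (by simpa [he] using hnat : HasSum (fun n : ℕ => e (-n)) _)
  have h0 : e 0 = 0 := by simp [he]
  rw [h0, sub_zero] at h
  norm_num at h
  exact h

/-- The power sums `∑ n ^ (2 j) |p̂ n|²` over the nonconstant Fourier modes, for `j ≤ 3`. -/
structure FourierMoments (p : ℝ → ℝ) (v : ℤ → ℝ) (M₀ M₁ M₂ M₃ : ℝ) : Prop where
  zero : v 0 = 0
  eq_norm_sq : ∀ n ≠ 0, v n = ‖angularCoeff p n‖ ^ 2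
  hasSum₀ : HasSum v M₀
  hasSum₁ : HasSum (fun n : ℤ => (n : ℝ) ^ 2 * v n) M₁
  hasSum₂ : HasSum (fun n : ℤ => (n : ℝ) ^ 4 * v n) M₂
  hasSum₃ : HasSum (fun n : ℤ => (n : ℝ) ^ 6 * v n) M₃
  integral₀ : ∫ θ in (0 : ℝ)..(2 * π), p θ ^ 2 =
    (∫ θ in (0 : ℝ)..(2 * π), p θ) ^ 2 / (2 * π) + 2 * π * M₀
  integral₁ : ∫ θ in (0 : ℝ)..(2 * π), deriv p θ ^ 2 = 2 * π * M₁
  integral₂ : ∫ θ in (0 : ℝ)..(2 * π), deriv (deriv p) θ ^ 2 = 2 * π * M₂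
  integral₃ : ∫ θ in (0 : ℝ)..(2 * π), deriv (deriv (deriv p)) θ ^ 2 = 2 * π * M₃

theorem exists_fourierMoments {p : ℝ → ℝ} (hp : ContDiff ℝ ∞ p)
    (hper : Function.Periodic p (2 * π)) :
    ∃ v M₀ M₁ M₂ M₃, FourierMoments p v M₀ M₁ M₂ M₃ := by
  have hpi := pi_pos
  have s1 := hp.deriv_infty
  have s2 := s1.deriv_infty
  have s3 := s2.deriv_infty
  have q1 := hper.deriv_periodic
  have q2 := q1.deriv_periodic
  set w : ℤ → ℝ := fun n => ‖angularCoeff p n‖ ^ 2 with hw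
  have hw0 : w 0 = (∫ θ in (0 : ℝ)..(2 * π), p θ) ^ 2 / (2 * π) ^ 2 := by
    simp only [hw]
    rw [angularCoeff_eq_cos_sin hp.continuous]
    simp only [Int.cast_zero, zero_mul, cos_zero, sin_zero, mul_one, mul_zero,
      intervalIntegral.integral_zero, Complex.ofReal_zero, sub_zero]
    rw [← Complex.ofReal_mul, Complex.norm_real, Real.norm_eq_abs, sq_abs]
    field_simp
  set v : ℤ → ℝ := fun n => if n = 0 then 0 else w n with hv
  have h0 := hasSum_sq_angularCoeff hp.continuous
  have h1 := hasSum_sq_angularCoeff s1.continuous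
  have h2 := hasSum_sq_angularCoeff s2.continuous
  have h3 := hasSum_sq_angularCoeff s3.continuous
  simp only [norm_sq_angularCoeff_deriv s2 q2, norm_sq_angularCoeff_deriv s1 q1,
    norm_sq_angularCoeff_deriv hp hper] at h1 h2 h3
  have hmul : ∀ (n : ℤ) (k : ℕ), k ≠ 0 → (n : ℝ) ^ k * v n = (n : ℝ) ^ k * w n := by
    intro n k hk
    rcases eq_or_ne n 0 with rfl | hn
    · simp [hk]
    · simp [hv, hn]
  refine ⟨v, _, _, _, _, by simp [hv], fun n hn => by simp [hv, hn, hw],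
    (h0.sub (hasSum_ite_eq 0 (w 0))).congr_fun fun n => ?_,
    h1.congr_fun fun n => hmul n 2 two_ne_zero,
    h2.congr_fun fun n => ?_, h3.congr_fun fun n => ?_, ?_, ?_, ?_, ?_⟩
  · rcases eq_or_ne n 0 with rfl | hn
    · simp [hv, hw]
    · simp [hv, hn, hw]
  · rw [hmul n 4 (by norm_num)]; ring
  · rw [hmul n 6 (by norm_num)]; ring
  · rw [hw0]; field_simp; ring
  all_goals field_simp

namespace FourierMoments

variable {p : ℝ → ℝ} {v : ℤ → ℝ} {M₀ M₁ M₂ M₃ : ℝ}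

theorem nonneg (h : FourierMoments p v M₀ M₁ M₂ M₃) (n : ℤ) : 0 ≤ v n := by
  rcases eq_or_ne n 0 with rfl | hn
  · exact h.zero.ge
  · rw [h.eq_norm_sq n hn]; positivity

theorem sq_cases {n : ℤ} (hn : n ≠ 0) : (n : ℝ) ^ 2 = 1 ∨ 4 ≤ (n : ℝ) ^ 2 := by
  rcases eq_or_ne (n ^ 2) 1 with h | h
  · left; exact_mod_cast h
  · right
    have h1 : n ≠ 1 := by rintro rfl; simp at h
    have h2 : n ≠ -1 := by rintro rfl; simp at h
    have : 4 ≤ n ^ 2 := by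
      rcases lt_or_gt_of_ne hn with h3 | h3
      · have : n ≤ -2 := by omega
        nlinarith
      · have : 2 ≤ n := by omega
        nlinarith
    exact_mod_cast this

/-- A linear combination of the moments is nonnegative if its symbol is. -/
theorem lin_comb_nonneg (h : FourierMoments p v M₀ M₁ M₂ M₃) {c₀ c₁ c₂ c₃ : ℝ}
    (hc : ∀ N : ℝ, N = 1 ∨ 4 ≤ N → 0 ≤ c₀ + c₁ * N + c₂ * N ^ 2 + c₃ * N ^ 3) :
    0 ≤ c₀ * M₀ + c₁ * M₁ + c₂ * M₂ + c₃ * M₃ := by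
  have hs := (((h.hasSum₀.mul_left c₀).add (h.hasSum₁.mul_left c₁)).add
    (h.hasSum₂.mul_left c₂)).add (h.hasSum₃.mul_left c₃)
  refine hs.nonneg fun n => ?_
  rcases eq_or_ne n 0 with rfl | hn
  · simp [h.zero]
  · have := mul_nonneg (hc _ (sq_cases hn)) (h.nonneg n)
    refine this.trans_eq ?_
    ring

/-- Uniform bound for a function by its first moments, modulo the modes of order at most one. -/
theorem sq_sub_low_order_le (h : FourierMoments p v M₀ M₁ M₂ M₃) (hp : ContDiff ℝ ∞ p)
    (hper : Function.Periodic p (2 * π)) (θ : ℝ) :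
    (p θ - ((1 / π * ∫ θ in (0 : ℝ)..(2 * π), p θ * cos θ) * cos θ +
        (1 / π * ∫ θ in (0 : ℝ)..(2 * π), p θ * sin θ) * sin θ +
        (∫ θ in (0 : ℝ)..(2 * π), p θ) / (2 * π))) ^ 2 ≤ 3 / 2 * (M₁ - M₀) := by
  set e : ℤ → ℝ := fun n => if n ^ 2 ≤ 1 then (0 : ℝ) else 1 / ((n : ℝ) ^ 2 - 1) with he
  have hbsum : HasSum (fun n : ℤ => (n : ℝ) ^ 2 * v n - v n) (M₁ - M₀) :=
    h.hasSum₁.sub h.hasSum₀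
  set s : Finset ℤ := {-1, 0, 1} with hs
  have hmem : ∀ n : ℤ, n ∉ s → n ≠ 0 ∧ ¬ n ^ 2 ≤ 1 ∧ 0 < (n : ℝ) ^ 2 - 1 := by
    intro n hn
    simp only [hs, Finset.mem_insert, Finset.mem_singleton, not_or] at hn
    have h4 : 4 ≤ (n : ℝ) ^ 2 := by
      refine (sq_cases hn.2.1).resolve_left fun h1 => ?_
      have h1' : n ^ 2 = 1 := by exact_mod_cast h1
      have h2 : (n - 1) * (n + 1) = 0 := by linear_combination h1'
      rcases mul_eq_zero.1 h2 with h3 | h3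
      · exact hn.2.2 (by omega)
      · exact hn.1 (by omega)
    refine ⟨hn.2.1, fun hle => ?_, by linarith⟩
    have : (n : ℝ) ^ 2 ≤ 1 := by exact_mod_cast hle
    linarith
  have hb0 : ∀ n : ℤ, 0 ≤ (n : ℝ) ^ 2 * v n - v n := by
    intro n
    rcases eq_or_ne n 0 with rfl | hn
    · simp [h.zero]
    · have := h.nonneg n
      rcases sq_cases hn with h1 | h1 <;> nlinarith
  have he0 : ∀ n : ℤ, 0 ≤ e n := by
    intro n
    simp only [he]
    split_ifs with h1
    · exact le_rfl
    · have : (1 : ℝ) < (n : ℝ) ^ 2 := by exact_mod_cast not_le.1 h1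
      exact one_div_nonneg.2 (by linarith)
  -- Cauchy–Schwarz in the form of the weighted mean inequality `2|p̂ n| ≤ t/(n² - 1) + (n² - 1)|p̂
  -- n|²/t`, which also yields the summability of the coefficients.
  have hnorm : ∀ t : ℝ, 0 < t → ∀ n ∉ s, ‖angularCoeff p n‖ ≤
      (t * e n + ((n : ℝ) ^ 2 * v n - v n) * t⁻¹) * 2⁻¹ := by
    intro t ht n hn
    obtain ⟨h0, h1, h2⟩ := hmem n hn
    rw [h.eq_norm_sq n h0]
    simp only [he, if_neg h1]
    set a := ‖angularCoeff p n‖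
    set k := (n : ℝ) ^ 2 - 1 with hk
    have hk' : (n : ℝ) ^ 2 = k + 1 := by rw [hk]; ring
    rw [hk']
    have : 0 ≤ (t - k * a) ^ 2 / (2 * t * k) := by positivity
    have e1 : (t * (1 / k) + ((k + 1) * a ^ 2 - a ^ 2) * t⁻¹) * 2⁻¹ - a =
        (t - k * a) ^ 2 / (2 * t * k) := by
      field_simp
      ring
    linarith
  have hbd : ∀ t : ℝ, HasSum (fun n : ℤ => (t * e n + ((n : ℝ) ^ 2 * v n - v n) * t⁻¹) * 2⁻¹)
      ((t * (3 / 2) + (M₁ - M₀) * t⁻¹) * 2⁻¹) := fun t =>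
    ((hasSum_inv_sq_sub_one.mul_left t).add (hbsum.mul_right t⁻¹)).mul_right 2⁻¹
  have hsummable : Summable (angularCoeff p) := by
    refine Summable.of_norm_bounded_eventually (hbd 1).summable ?_
    refine (s.finite_toSet).subset fun n hn => ?_
    by_contra hns
    exact hn (hnorm 1 one_pos n hns)
  have hF := hasSum_angularCoeff_mul_exp hp.continuous hper hsummable θ
  set F : ℤ → ℂ := fun n => angularCoeff p n * Complex.exp (n * θ * Complex.I) with hFdef
  have hlow : HasSum (fun n => if n ∈ s then F n else 0) (∑ n ∈ s, F n) := by
    have : HasSum (fun n => if n ∈ s then F n else 0) (∑ n ∈ s, if n ∈ s then F n else 0) :=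
      hasSum_sum_of_ne_finset_zero fun n hn => if_neg hn
    rwa [Finset.sum_congr rfl fun n hn => if_pos hn] at this
  have hdiff := hF.sub hlow
  rw [hs, angularCoeff_low_order hp.continuous θ, ← Complex.ofReal_sub] at hdiff
  set d := p θ - ((1 / π * ∫ θ in (0 : ℝ)..(2 * π), p θ * cos θ) * cos θ +
        (1 / π * ∫ θ in (0 : ℝ)..(2 * π), p θ * sin θ) * sin θ +
        (∫ θ in (0 : ℝ)..(2 * π), p θ) / (2 * π)) with hd
  have hbound : ∀ t : ℝ, 0 < t → |d| ≤ (t * (3 / 2) + (M₁ - M₀) * t⁻¹) * 2⁻¹ := by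
    intro t ht
    have := tsum_of_norm_bounded (hbd t) (f := fun n => F n - if n ∈ s then F n else 0) fun n => by
      by_cases hn : n ∈ s
      · simp only [if_pos hn, sub_self, norm_zero]
        have := mul_nonneg (hb0 n) (inv_pos.2 ht).le
        have := mul_nonneg ht.le (he0 n)
        linarith
      · simp only [if_neg hn, sub_zero, hFdef, norm_mul]
        rw [show (n : ℂ) * θ * Complex.I = ((n * θ : ℝ) : ℂ) * Complex.I by push_cast; ring,
          Complex.norm_exp_ofReal_mul_I, mul_one]
        exact hnorm t ht n hn
    rwa [hdiff.tsum_eq, Complex.norm_real, Real.norm_eq_abs] at this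
  have hB : 0 ≤ M₁ - M₀ := hbsum.nonneg hb0
  rcases eq_or_ne d 0 with h0 | h0
  · rw [h0]; nlinarith
  · have hpos : 0 < |d| := abs_pos.2 h0
    -- This `t` makes the first half of the bound equal to `|d|/2`, which is absorbed on the left.
    have h1 := hbound (|d| / (3 / 2)) (by positivity)
    have h2 : |d| ≤ (M₁ - M₀) * (|d| / (3 / 2))⁻¹ := by
      rw [div_mul_cancel₀ _ (by norm_num)] at h1
      linarith
    rw [inv_div, mul_div_assoc', le_div_iff₀ hpos] at h2
    rw [← sq_abs]
    linarith

end FourierMoments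

/-! ### The terms of the functional in moments, and their comparison with the deficit. -/

theorem integral_deriv_mul_deriv_radiusFn {p : ℝ → ℝ} (hp : ContDiff ℝ ∞ p)
    (hper : Function.Periodic p (2 * π)) :
    ∫ θ in (0 : ℝ)..(2 * π), deriv p θ * deriv (radiusFn p) θ =
      (∫ θ in (0 : ℝ)..(2 * π), deriv p θ ^ 2) -
        ∫ θ in (0 : ℝ)..(2 * π), deriv (deriv p) θ ^ 2 := by
  rw [← integral_mul_radiusFn hp.deriv_infty hper.deriv_periodic]
  simp only [deriv_radiusFn hp, radiusFn]

theorem integral_radiusFn_sq {p : ℝ → ℝ} (hp : ContDiff ℝ ∞ p)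
    (hper : Function.Periodic p (2 * π)) :
    ∫ θ in (0 : ℝ)..(2 * π), radiusFn p θ ^ 2 =
      (∫ θ in (0 : ℝ)..(2 * π), p θ ^ 2) - 2 * (∫ θ in (0 : ℝ)..(2 * π), deriv p θ ^ 2) +
        ∫ θ in (0 : ℝ)..(2 * π), deriv (deriv p) θ ^ 2 := by
  have c0 := hp.continuous
  have c2 := hp.deriv_infty.deriv_infty.continuous
  have cr := hp.radiusFn.continuous
  have hi : ∀ {f : ℝ → ℝ}, Continuous f → IntervalIntegrable f volume 0 (2 * π) := fun hf =>
    hf.intervalIntegrable _ _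
  have h1 := integral_mul_radiusFn hp hper
  have e : (fun θ => radiusFn p θ ^ 2) =
      fun θ => 2 * (p θ * radiusFn p θ) - p θ ^ 2 + deriv (deriv p) θ ^ 2 := by
    funext θ; simp only [radiusFn]; ring
  rw [e, intervalIntegral.integral_add (hi (by fun_prop)) (hi (by fun_prop)),
    intervalIntegral.integral_sub (hi (by fun_prop)) (hi (by fun_prop)),
    intervalIntegral.integral_const_mul, h1]
  ring

theorem integral_deriv_radiusFn_sq {p : ℝ → ℝ} (hp : ContDiff ℝ ∞ p)
    (hper : Function.Periodic p (2 * π)) :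
    ∫ θ in (0 : ℝ)..(2 * π), deriv (radiusFn p) θ ^ 2 =
      (∫ θ in (0 : ℝ)..(2 * π), deriv p θ ^ 2) -
        2 * (∫ θ in (0 : ℝ)..(2 * π), deriv (deriv p) θ ^ 2) +
        ∫ θ in (0 : ℝ)..(2 * π), deriv (deriv (deriv p)) θ ^ 2 := by
  rw [← integral_radiusFn_sq hp.deriv_infty hper.deriv_periodic]
  simp only [deriv_radiusFn hp, radiusFn]

namespace IsSmoothStrictlyConvexDomain

variable {K : Set Plane}

theorem perimeter_nonneg (hK : IsSmoothStrictlyConvexDomain K) : 0 ≤ perimeter K := by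
  rw [perimeter_eq_integral_radiusFn hK.contDiff_supportFn hK.radiusFn_pos]
  exact intervalIntegral.integral_nonneg two_pi_pos.le fun θ _ => (hK.radiusFn_pos θ).le

theorem area_eq_moments (hK : IsSmoothStrictlyConvexDomain K) {v : ℤ → ℝ} {M₀ M₁ M₂ M₃ : ℝ}
    (h : FourierMoments (supportFn K) v M₀ M₁ M₂ M₃) :
    area K = perimeter K ^ 2 / (4 * π) + π * (M₀ - M₁) := by
  have hpi := pi_pos
  rw [hK.area_eq, integral_mul_radiusFn hK.contDiff_supportFn (supportFn_periodic K),
    h.integral₀, h.integral₁, hK.perimeter_eq]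
  field_simp
  ring

theorem integral_curvatureRadius_sq (hK : IsSmoothStrictlyConvexDomain K) {v : ℤ → ℝ}
    {M₀ M₁ M₂ M₃ : ℝ} (h : FourierMoments (supportFn K) v M₀ M₁ M₂ M₃) :
    ∫ θ in (0 : ℝ)..(2 * π), curvatureRadius K θ ^ 2 =
      perimeter K ^ 2 / (2 * π) + 2 * π * (M₀ - 2 * M₁ + M₂) := by
  simp only [curvatureRadius_eq hK.contDiff_supportFn hK.radiusFn_pos]
  rw [integral_radiusFn_sq hK.contDiff_supportFn (supportFn_periodic K),
    h.integral₀, h.integral₁, h.integral₂, hK.perimeter_eq]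
  ring

theorem abs_orientedAreaLocus (hK : IsSmoothStrictlyConvexDomain K) {v : ℤ → ℝ}
    {M₀ M₁ M₂ M₃ : ℝ} (h : FourierMoments (supportFn K) v M₀ M₁ M₂ M₃) :
    |orientedAreaLocus K| = π * (M₂ - M₁) := by
  have hpi := pi_pos
  have hnn : 0 ≤ M₂ - M₁ := by
    have := h.lin_comb_nonneg (c₀ := 0) (c₁ := -1) (c₂ := 1) (c₃ := 0) fun N hN => by
      rcases hN with rfl | hN
      · norm_num
      · nlinarith
    linarith
  have e : orientedAreaLocus K = -(π * (M₂ - M₁)) := by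
    rw [orientedAreaLocus_eq hK.contDiff_supportFn hK.radiusFn_pos,
      integral_deriv_mul_deriv_radiusFn hK.contDiff_supportFn (supportFn_periodic K),
      h.integral₁, h.integral₂]
    ring
  rw [e, abs_neg, abs_of_nonneg (mul_nonneg hpi.le hnn)]

theorem integral_locusCurvatureRadius_sq (hK : IsSmoothStrictlyConvexDomain K) {v : ℤ → ℝ}
    {M₀ M₁ M₂ M₃ : ℝ} (h : FourierMoments (supportFn K) v M₀ M₁ M₂ M₃) :
    ∫ θ in (0 : ℝ)..(2 * π), locusCurvatureRadius K θ ^ 2 = 2 * π * (M₁ - 2 * M₂ + M₃) := by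
  simp only [locusCurvatureRadius_eq hK.contDiff_supportFn hK.radiusFn_pos, sq_abs]
  rw [integral_deriv_radiusFn_sq hK.contDiff_supportFn (supportFn_periodic K),
    h.integral₁, h.integral₂, h.integral₃]
  ring

/-- Bonnesen's inequality with the deficit written as `4π² (M₁ - M₀)`; it serves for the term with
`λ ≤ 0`. -/
theorem bonnesen_moments (hK : IsSmoothStrictlyConvexDomain K) {v : ℤ → ℝ} {M₀ M₁ M₂ M₃ : ℝ}
    (h : FourierMoments (supportFn K) v M₀ M₁ M₂ M₃) :
    (outerRadius K - innerRadius K) ^ 2 ≤ 4 * (M₁ - M₀) := by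
  have hpi := pi_pos
  have hb := hK.bonnesen
  have e : perimeter K ^ 2 - 4 * π * area K = π ^ 2 * (4 * (M₁ - M₀)) := by
    rw [hK.area_eq_moments h]; field_simp; ring
  rw [e] at hb
  exact le_of_mul_le_mul_left hb (by positivity)

/-- The Steiner disk approximates the domain uniformly in terms of the isoperimetric deficit. -/
theorem h1Dist_sq_le (hK : IsSmoothStrictlyConvexDomain K) {v : ℤ → ℝ} {M₀ M₁ M₂ M₃ : ℝ}
    (h : FourierMoments (supportFn K) v M₀ M₁ M₂ M₃) :
    h1Dist K (steinerDisk K) ^ 2 ≤ 3 / 2 * (M₁ - M₀) := by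
  have hpi := pi_pos
  have hle : ∀ θ, |supportFn K θ - supportFn (steinerDisk K) θ| ≤ √(3 / 2 * (M₁ - M₀)) := by
    intro θ
    have h1 := h.sq_sub_low_order_le hK.contDiff_supportFn (supportFn_periodic K) θ
    refine abs_le_sqrt ?_
    rw [steinerDisk, supportFn_closedBall _ (div_nonneg hK.perimeter_nonneg (by positivity)),
      hK.perimeter_eq]
    exact h1
  have hB : 0 ≤ 3 / 2 * (M₁ - M₀) :=
    (sq_nonneg _).trans (h.sq_sub_low_order_le hK.contDiff_supportFn (supportFn_periodic K) 0)
  have h0 : 0 ≤ h1Dist K (steinerDisk K) := by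
    refine Real.sSup_nonneg ?_
    rintro _ ⟨θ, -, rfl⟩
    exact abs_nonneg _
  have h2 : h1Dist K (steinerDisk K) ≤ √(3 / 2 * (M₁ - M₀)) := by
    refine csSup_le ((Set.nonempty_Icc.2 two_pi_pos.le).image _) ?_
    rintro _ ⟨θ, -, rfl⟩
    exact hle θ
  calc _ ≤ √(3 / 2 * (M₁ - M₀)) ^ 2 := pow_le_pow_left₀ h0 h2 2
    _ = _ := sq_sqrt hB

/-- The oscillation of the curvature radius dominates the isoperimetric deficit. -/
theorem le_sq_max_sub_min_curvatureRadius (hK : IsSmoothStrictlyConvexDomain K) {v : ℤ → ℝ}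
    {M₀ M₁ M₂ M₃ : ℝ} (h : FourierMoments (supportFn K) v M₀ M₁ M₂ M₃) :
    4 * (M₁ - M₀) ≤ (maxCurvatureRadius K - minCurvatureRadius K) ^ 2 := by
  have hpi := pi_pos
  have hp := hK.contDiff_supportFn
  have cr := hp.radiusFn.continuous
  have hcr := curvatureRadius_eq hp hK.radiusFn_pos
  have hcomp : IsCompact (curvatureRadius K '' Set.Icc 0 (2 * π)) := by
    rw [show curvatureRadius K = radiusFn (supportFn K) from funext hcr]
    exact isCompact_Icc.image cr
  set a := minCurvatureRadius K with ha
  set b := maxCurvatureRadius K with hb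
  have hle : ∀ θ ∈ Set.Icc 0 (2 * π), a ≤ radiusFn (supportFn K) θ ∧
      radiusFn (supportFn K) θ ≤ b := fun θ hθ => by
    rw [← hcr]
    exact ⟨csInf_le hcomp.bddBelow ⟨θ, hθ, rfl⟩, le_csSup hcomp.bddAbove ⟨θ, hθ, rfl⟩⟩
  -- The integrand is `(ρ - a)(b - ρ)`. Its nonnegativity bounds the variance of `ρ` by `(b -
  -- a)²/4`.
  have hpos : 0 ≤ ∫ θ in (0 : ℝ)..(2 * π),
      ((a + b) * radiusFn (supportFn K) θ - radiusFn (supportFn K) θ ^ 2 - a * b) := by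
    refine intervalIntegral.integral_nonneg two_pi_pos.le fun θ hθ => ?_
    obtain ⟨h1, h2⟩ := hle θ hθ
    nlinarith
  have hi : ∀ {f : ℝ → ℝ}, Continuous f → IntervalIntegrable f volume 0 (2 * π) := fun hf =>
    hf.intervalIntegrable _ _
  have hsq := hK.integral_curvatureRadius_sq h
  simp only [hcr] at hsq
  rw [intervalIntegral.integral_sub (hi (by fun_prop)) (hi (by fun_prop)),
    intervalIntegral.integral_sub (hi (by fun_prop)) (hi (by fun_prop)),
    intervalIntegral.integral_const_mul, intervalIntegral.integral_const, hsq,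
    ← perimeter_eq_integral_radiusFn hp hK.radiusFn_pos, smul_eq_mul, sub_zero] at hpos
  -- The symbol is `(N - 1)(N - 4)` with `N = n²`.
  have hdef : 0 ≤ (M₀ - 2 * M₁ + M₂) - 3 * (M₁ - M₀) := by
    have := h.lin_comb_nonneg (c₀ := 4) (c₁ := -5) (c₂ := 1) (c₃ := 0) fun N hN => by
      rcases hN with rfl | hN
      · norm_num
      · nlinarith
    linarith
  have hnn : 0 ≤ M₁ - M₀ := by
    have := h.lin_comb_nonneg (c₀ := -1) (c₁ := 1) (c₂ := 0) (c₃ := 0) fun N hN => by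
      rcases hN with rfl | hN <;> linarith
    linarith
  set L := perimeter K
  have e : (a + b) * L - (L ^ 2 / (2 * π) + 2 * π * (M₀ - 2 * M₁ + M₂)) - 2 * π * (a * b) =
      π / 2 * (b - a) ^ 2 - (L - π * (a + b)) ^ 2 / (2 * π) - 2 * π * (M₀ - 2 * M₁ + M₂) := by
    field_simp
    ring
  rw [e] at hpos
  have h3 : 0 ≤ (L - π * (a + b)) ^ 2 / (2 * π) := by positivity
  have h4 : 0 ≤ π / 2 * ((b - a) ^ 2 - 4 * (M₀ - 2 * M₁ + M₂)) := by linarith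
  have h5 := nonneg_of_mul_nonneg_right h4 (by positivity)
  linarith

/-- Stability of `W`: it dominates the isoperimetric deficit. -/
theorem le_isoW (hK : IsSmoothStrictlyConvexDomain K) {v : ℤ → ℝ} {M₀ M₁ M₂ M₃ : ℝ}
    (h : FourierMoments (supportFn K) v M₀ M₁ M₂ M₃) {α δ μ σ η lam ξ ζ : ℝ}
    (hη : 0 ≤ η) (hξ : 0 ≤ ξ) (hζ : 0 ≤ ζ) (hlam : lam ≤ 0)
    (h1 : 0 ≤ 2 * α + 4 * π * δ + μ - 4 * ζ) (h2 : 0 ≤ 2 * α + σ - 2 * η - 4 * ζ) :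
    (6 * π * α - π * μ + 4 * π * σ + 24 * π * η + 4 * lam + 4 * ξ - 12 * π * ζ) * (M₁ - M₀) ≤
      isoW α δ μ σ η lam ξ ζ K := by
  have hpi := pi_pos
  -- The symbol of the `α`, `μ`, `σ`, `η` terms, with `α - 2ζ` for `α`, minus their share of `D (N -
  -- 1)`. It equals `(N - 1)(N - 4)(2(α - 2ζ) + σ + 2η(N + 3))`, so the share of `D` is the one for
  -- which the modes `n = ±2` contribute nothing.
  have hsym := h.lin_comb_nonneg
    (c₀ := 2 * (α - 2 * ζ) + μ + (6 * (α - 2 * ζ) - μ + 4 * σ + 24 * η))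
    (c₁ := -(4 * (α - 2 * ζ)) - μ - σ + 2 * η -
      (6 * (α - 2 * ζ) - μ + 4 * σ + 24 * η))
    (c₂ := 2 * (α - 2 * ζ) + σ - 4 * η) (c₃ := 2 * η) fun N hN => by
      have hc : 0 ≤ (N - 1) * (N - 4) := by
        rcases hN with rfl | hN
        · norm_num
        · exact mul_nonneg (by linarith) (by linarith)
      have hN1 : 1 ≤ N := by rcases hN with rfl | hN <;> linarith
      have hs : 0 ≤ 2 * (α - 2 * ζ) + σ + 2 * η * (N + 3) := by nlinarith
      refine (mul_nonneg hc hs).trans_eq ?_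
      ring
  have hX := hK.integral_curvatureRadius_sq h
  have hXnn : 0 ≤ ∫ θ in (0 : ℝ)..(2 * π), curvatureRadius K θ ^ 2 :=
    intervalIntegral.integral_nonneg two_pi_pos.le fun θ _ => sq_nonneg _
  have hζX := mul_nonneg hζ hXnn
  have hζκ := mul_nonneg hζ (curvatureSqIntegral_nonneg (K := K))
  have hl := mul_le_mul_of_nonpos_left (hK.bonnesen_moments h) hlam
  have hx := mul_le_mul_of_nonneg_left (hK.le_sq_max_sub_min_curvatureRadius h) hξ
  have hL := mul_nonneg h1 (by positivity : 0 ≤ perimeter K ^ 2 / (4 * π))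
  have hsym' := mul_nonneg hpi.le hsym
  rw [isoW, hK.area_eq_moments h, hK.abs_orientedAreaLocus h,
    hK.integral_locusCurvatureRadius_sq h]
  -- Splitting off `2ζ ∫ ρ² ≥ 0`, which is then discarded together with `ζ ∮ κ² ds ≥ 0`, accounts
  -- for the terms `-4ζ` and `-12πζ` in the hypotheses and in `D`.
  have hαX : α * (∫ θ in (0 : ℝ)..(2 * π), curvatureRadius K θ ^ 2) =
      (α - 2 * ζ) * (perimeter K ^ 2 / (2 * π) + 2 * π * (M₀ - 2 * M₁ + M₂)) +
        2 * (ζ * ∫ θ in (0 : ℝ)..(2 * π), curvatureRadius K θ ^ 2) := by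
    rw [← hX]; ring
  rw [hαX]
  have eL : (2 * α + 4 * π * δ + μ - 4 * ζ) * (perimeter K ^ 2 / (4 * π)) =
      (α - 2 * ζ) * (perimeter K ^ 2 / (2 * π)) + δ * perimeter K ^ 2 +
        μ * (perimeter K ^ 2 / (4 * π)) := by
    field_simp
    ring
  rw [eL] at hL
  linear_combination hsym' + hL + 2 * hζX + hζκ + hl + hx

end IsSmoothStrictlyConvexDomain

/-! ### Disks and the conclusion. -/

theorem radiusFn_trig (x y r θ : ℝ) :
    radiusFn (fun θ => x * cos θ + y * sin θ + r) θ = r := by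
  have h := congrFun (radiusFn_sub_trig (p := fun _ => 0) contDiff_const (-x) (-y) (-r)).2 θ
  have e : (fun θ => 0 - (-x * cos θ + -y * sin θ) - -r) =
      fun θ => x * cos θ + y * sin θ + r := by
    funext θ; ring
  rw [e] at h
  simpa [radiusFn] using h

/-- A disk has no isoperimetric deficit, and `W` is a multiple of its squared radius. -/
theorem isoW_closedBall {x : Plane} {r : ℝ} (hr : 0 < r)
    (hK : IsSmoothStrictlyConvexDomain (Metric.closedBall x r)) (α δ μ σ η lam ξ : ℝ) :
    perimeter (Metric.closedBall x r) ^ 2 = 4 * π * area (Metric.closedBall x r) ∧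
    isoW α δ μ σ η lam ξ 0 (Metric.closedBall x r) =
      π * r ^ 2 * (2 * α + 4 * π * δ + μ) := by
  have hpi := pi_pos
  have hp := hK.contDiff_supportFn
  set K := Metric.closedBall x r with hKdef
  have hsupp : supportFn K = fun θ => x 0 * cos θ + x 1 * sin θ + r :=
    funext fun θ => supportFn_closedBall x hr.le θ
  have hrad : ∀ θ, radiusFn (supportFn K) θ = r := fun θ => by rw [hsupp, radiusFn_trig]
  have hrad' : radiusFn (supportFn K) = fun _ => r := funext hrad
  have hcr : ∀ θ, curvatureRadius K θ = r := fun θ => by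
    rw [curvatureRadius_eq hp hK.radiusFn_pos, hrad]
  have hL : perimeter K = 2 * π * r := by
    rw [perimeter_eq_integral_radiusFn hp hK.radiusFn_pos]
    simp [hrad']
  have hA : area K = π * r ^ 2 := by
    rw [hK.area_eq]
    simp only [hrad']
    rw [intervalIntegral.integral_mul_const, ← hK.perimeter_eq, hL]
    ring
  have hO : orientedAreaLocus K = 0 := by
    rw [orientedAreaLocus_eq hp hK.radiusFn_pos]
    simp [hrad']
  have hlc : ∀ θ, locusCurvatureRadius K θ = 0 := fun θ => by
    rw [locusCurvatureRadius_eq hp hK.radiusFn_pos]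
    simp [hrad']
  have hLA : perimeter K ^ 2 = 4 * π * area K := by rw [hL, hA]; ring
  -- Bonnesen's inequality with zero deficit makes the two radii equal, without computing either.
  have hR : (outerRadius K - innerRadius K) ^ 2 = 0 := by
    have hb := hK.bonnesen
    rw [hLA, sub_self] at hb
    refine le_antisymm ?_ (sq_nonneg _)
    exact nonpos_of_mul_nonpos_right hb (by positivity)
  have himg : curvatureRadius K '' Set.Icc 0 (2 * π) = {r} := by
    rw [show curvatureRadius K = fun _ => r from funext hcr]
    exact (Set.nonempty_Icc.2 two_pi_pos.le).image_const r
  refine ⟨hLA, ?_⟩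
  rw [isoW, hR, hO, hL, hA, maxCurvatureRadius, minCurvatureRadius, himg, csSup_singleton,
    csInf_singleton]
  simp only [hcr, hlc, intervalIntegral.integral_const, smul_eq_mul]
  simp
  ring

theorem theorem1p2 (K : Set Plane) (hK : IsSmoothStrictlyConvexDomain K)
    (α δ μ σ η lam ξ ζ : ℝ) :
    ((0 ≤ η ∧ 0 ≤ ξ ∧ 0 ≤ ζ ∧ lam ≤ 0 ∧
        0 ≤ 2 * α + 4 * π * δ + μ - 4 * ζ ∧
        0 ≤ 2 * α + σ - 2 * η - 4 * ζ ∧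
        0 < 6 * π * α - π * μ + 4 * π * σ + 24 * π * η + 4 * lam + 4 * ξ - 12 * π * ζ) →
      h1Dist K (steinerDisk K) ^ 2 ≤
        stabilityConst α μ σ η lam ξ ζ * isoW α δ μ σ η lam ξ ζ K) ∧
    ((∃ (x : Plane) (r : ℝ), 0 < r ∧ K = Metric.closedBall x r) →
      2 * α + 4 * π * δ + μ = 0 → ζ = 0 →
      h1Dist K (steinerDisk K) ^ 2 =
        stabilityConst α μ σ η lam ξ ζ * isoW α δ μ σ η lam ξ ζ K) := by
  obtain ⟨v, M₀, M₁, M₂, M₃, h⟩ :=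
    exists_fourierMoments hK.contDiff_supportFn (supportFn_periodic K)
  have hdist := hK.h1Dist_sq_le h
  constructor
  · rintro ⟨hη, hξ, hζ, hlam, h1, h2, hD⟩
    have hW := hK.le_isoW h hη hξ hζ hlam h1 h2
    have hM : 0 ≤ M₁ - M₀ := by
      have := (sq_nonneg (h1Dist K (steinerDisk K))).trans hdist
      linarith
    rw [stabilityConst]
    set D := 6 * π * α - π * μ + 4 * π * σ + 24 * π * η + 4 * lam + 4 * ξ - 12 * π * ζ
    have hW0 : 0 ≤ isoW α δ μ σ η lam ξ ζ K := (mul_nonneg hD.le hM).trans hW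
    calc h1Dist K (steinerDisk K) ^ 2 ≤ 3 / 2 * (M₁ - M₀) := hdist
      _ = 3 / (2 * D) * (D * (M₁ - M₀)) := by field_simp
      _ ≤ 3 / (2 * D) * isoW α δ μ σ η lam ξ ζ K :=
        mul_le_mul_of_nonneg_left hW (by positivity)
      _ ≤ _ := mul_le_mul_of_nonneg_right (le_max_right _ _) hW0
  · rintro ⟨x, r, hr, rfl⟩ hcoef rfl
    obtain ⟨hLA, hW⟩ := isoW_closedBall hr hK α δ μ σ η lam ξ
    have hpi := pi_pos
    have hM : M₁ - M₀ = 0 := by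
      have := hK.area_eq_moments h
      have e : π * (M₀ - M₁) = 0 := by
        rw [hLA] at this
        field_simp at this
        linarith
      rcases mul_eq_zero.1 e with h0 | h0
      · exact absurd h0 hpi.ne'
      · linarith
    -- Here `W = 0`, so the value of the constant is irrelevant; when `D = 0`, the convention `3 / 0
    -- = 0` makes it `1`.
    rw [hW, hcoef, mul_zero, mul_zero]
    rw [hM, mul_zero] at hdist
    exact le_antisymm hdist (sq_nonneg _)
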